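/- **Setting.** Let $R$ be a commutative ring with $2=0$ in $R$; everything is ungraded and homological, and no signs occur. A sequence $\epsilon=(\epsilon_1,\epsilon_2,\dots)$ always consists of non-negative reals. A weakly filtered $A_\infty$-category $\mathcal A$ over $R$ with discrepancy $\le\epsilon^{\mathcal A}$ (where $\epsilon^{\mathcal A}_1=0$) is an $A_\infty$-category with morphism modules $C(X,Y)$, operations $\mu_d:C(X_0,X_1)\otimes\cdots\otimes C(X_{d-1},X_d)\to C(X_0,X_d)$, $d\ge1$, and increasing filtrations $C^{\le\alpha}(X,Y)$, $\alpha\in\mathbb R$, by $R$-submodules, such that $\mu_d$ maps $C^{\le\alpha_1}\otimes\cdots\otimes C^{\le\alpha_d}$ into $C^{\le\alpha_1+\cdots+\alpha_d+\epsilon^{\mathcal A}_d}$. A weakly filtered module $\mathcal M$ has operations $\mu_d^{\mathcal M}:C(X_0,X_1)\otimes\cdots\otimes C(X_{d-2},X_{d-1})\otimes\mathcal M(X_{d-1})\to\mathcal M(X_0)$ and increasing filtrations $\mathcal M^{\le\alpha}(X)$ with the analogous property for some sequence $\epsilon^{\mathcal M}$ with $\epsilon^{\mathcal M}_1=0$.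 A module homomorphism is a pre-module homomorphism $f=(f_1,f_2,\dots)$ with $\mu_1^{\mathrm{mod}}(f)=0$; it shifts action by $\le\rho$ and has discrepancy $\le\epsilon^f$ if each $f_d$ raises the total filtration level by at most $\rho+\epsilon^f_d$. For such an $f:\mathcal M_0\to\mathcal M_1$, $\mathrm{Cone}(f;\rho,\epsilon^f)$ is the mapping cone with the filtration $\mathcal M_0^{\le\alpha-\rho-\epsilon^f_1}(X)\oplus\mathcal M_1^{\le\alpha}(X)$. The category $\mathcal A$ is h-unital in the weakly filtered sense with discrepancy of units $\le u^{\mathcal A}$, $u^{\mathcal A}\ge 0$, if cycles $e_X\in C^{\le u^{\mathcal A}}(X,X)$ representing the homology units are given for all objects $X$. For $\kappa\in\mathbb R$ consider the following assumptions. * $\mathcal A\in U^e(\kappa)$: for every $X$, $\mu_2(e_X,e_X)=e_X+\mu_1(c)$ for some $c\in C^{\le\kappa}(X,X)$. * $Y\in U^{R,e}(\kappa)$: for every $X$ the map $b\mapsto\mu_2(b,e_Y)$ on $C(X,Y)$ is chain homotopic to the identity by a chain homotopy that shifts action by $\le\kappa$. * $Y\in U_w(\kappa)$: for all $X$ and $\alpha$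 the map $C^{\le\alpha}(X,Y)\to C^{\le\alpha+\kappa}(X,Y)$, $b\mapsto\mu_2(e_X,b)$, is well defined and induces in homology the same map as the inclusion. Let $L_0,\dots,L_r$ be objects of $\mathcal A$ with Yoneda modules $\mathcal L_i$, $\mathcal L_i(X)=C(X,L_i)$. Put $\mathcal K_0=\mathcal L_0$ and $\mathcal K_i=\mathrm{Cone}\bigl(\mathcal L_i\xrightarrow{(\phi_i;\rho_i,\delta^{\phi_i})}\mathcal K_{i-1}\bigr)$ for $1\le i\le r$, where $\phi_i$ is a module homomorphism that shifts action by $\le\rho_i\in\mathbb R$ and has discrepancy $\le\delta^{\phi_i}$; put $\rho_0=0$. As an $R$-module, $\mathcal K_r(X)=C(X,L_0)\oplus\cdots\oplus C(X,L_r)$. For $\kappa\in\mathbb R$ put $$\chi_{m,d}=\sum_{j=1}^m\sum_{i=1}^{d+m}\delta_i^{\phi_j}+\sum_{i=1}^{d+m}\epsilon_i^{\mathcal A},\qquad \xi_q=\kappa+\sum_{i=1}^{q+3}\epsilon_i^{\mathcal A}+\sum_{j=1}^q\sum_{i=1}^{q+2}\delta_i^{\phi_j}.$$ **Theorem.** There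 are universal constants $B_q$, $C_r$, $D_{r,d}$, depending only on their indices and not on $R$, $\mathcal A$, the modules, $\kappa$ or the discrepancy data, such that the following holds. Let $\mathcal A$ be h-unital in the weakly filtered sense with discrepancy of units $\le u^{\mathcal A}$, let $\kappa\ge 2u^{\mathcal A}+\epsilon_2^{\mathcal A}$, and assume that $\mathcal A\in U^e(\kappa)$ and that $L_i\in U^{R,e}(\kappa)$ and $L_i\in U_w(\kappa)$ for all $0\le i\le r$. Then there is a weakly filtered $\mathcal A$-module $\mathcal M$ with the following properties. 1. $\mathcal M(X)=\mathcal K_r(X)=C(X,L_0)\oplus\cdots\oplus C(X,L_r)$ as $R$-modules, for every object $X$. 2. With respect to this splitting $\mu_1^{\mathcal M}=(a_{i,j})_{0\le i,j\le r}$, $a_{i,j}:C(X,L_j)\to C(X,L_i)$, where $a_{i,j}=0$ for $i>j$, $a_{i,i}=\mu_1^{\mathcal A}$, and there are elements $c_{q,p}\in C^{\le\alpha_{q,p}}(L_q,L_p)$, $0\le p<q\le r$, independent of $X$, with $\alpha_{q,p}=\rho_q-\rho_p+B_q\xi_q$, such that for $i<j$ $$a_{i,j}(-)=\sum_{d\ge2}\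 \sum_{i=k_1<k_2<\cdots<k_d=j}\mu_d^{\mathcal A}(-,c_{k_d,k_{d-1}},\dots,c_{k_2,k_1}).$$ 3. There is a quasi-isomorphism of $\mathcal A$-modules $\sigma:\mathcal K_r\to\mathcal M$ that shifts action by $\le\rho^\sigma$ and has discrepancy $\le\epsilon^\sigma$, where $\rho^\sigma\le C_r\,\xi_r$ and $\epsilon_d^\sigma\le D_{r,d}\,\chi_{r,d}$ for all $d\ge1$. 4. For every $X$, $\sigma_1:\mathcal K_r(X)\to\mathcal M(X)$ is an isomorphism of chain complexes, and its matrix with respect to the splittings is upper triangular with identity maps on the diagonal. 5. The inverse $\sigma_1^{-1}:\mathcal M(X)\to\mathcal K_r(X)$ is filtered, i.e. shifts action by $\le0$. 6. For $0\le j\le r$ the diagonal entry $\Delta_j=\mathrm{id}:C(X,L_j)\to C(X,L_j)$ of $\sigma_1$, with the filtration inherited from $\mathcal K_r(X)$ on the domain and from $\mathcal M(X)$ on the target, shifts action by $\le\rho^\sigma$. For $j=0$, $C(X,L_0)$ is a subcomplex of both $\mathcal K_r(X)$ and $\mathcal M(X)$, the two inherited filtrations on it coincide, and so $\Delta_0$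 preserves the filtration. -/

import Mathlib

universe u v w

namespace WeaklyFiltered

/-! ### Composable tuples -/

/-- Composable tuples `(a₁, …, a_d)` with `a_i ∈ C(X_{i-1}, X_i)`, from `X₀ = X` to `X_d = Y`;
the empty tuple is allowed. -/
inductive Path {Ob : Type w} (C : Ob → Ob → Type v) : Ob → Ob → Type (max w v)
  | nil (X : Ob) : Path C X X
  | cons {X Y Z : Ob} (a : C X Y) (p : Path C Y Z) : Path C X Z

namespace Path

variable {Ob : Type w} {C : Ob → Ob → Type v}

/-- The number `d` of entries of the tuple. -/
def length : {X Y : Ob} → Path C X Y → ℕ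
  | _, _, nil _ => 0
  | _, _, cons _ p => p.length + 1

/-- Concatenation of composable tuples. -/
def append : {X Y Z : Ob} → Path C X Y → Path C Y Z → Path C X Z
  | _, _, _, nil _, q => q
  | _, _, _, cons a p, q => cons a (append p q)

/-- The tuple with a single entry. -/
def single {X Y : Ob} (a : C X Y) : Path C X Y := cons a (nil Y)

/-- The sum of `F q s` over all decompositions `p = q ++ s`, with empty `q` or `s` allowed. -/
def sumSplit {G : Type*} [AddCommMonoid G] :
    {X Y : Ob} → (p : Path C X Y) → (∀ Z : Ob, Path C X Z → Path C Z Y → G) → G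
  | _, _, nil X, F => F X (nil X) (nil X)
  | _, _, cons (X := X) a p, F =>
      F X (nil X) (cons a p) + sumSplit p (fun Z q s => F Z (cons a q) s)

/-- The sum of `F q t s` over all decompositions `p = q ++ t ++ s`, with empty pieces allowed. -/
def sumSplit₃ {G : Type*} [AddCommMonoid G] {X Y : Ob} (p : Path C X Y)
    (F : ∀ Z W : Ob, Path C X Z → Path C Z W → Path C W Y → G) : G :=
  p.sumSplit fun Z q r => r.sumSplit fun W t s => F Z W q t s

/-- `p.Level F α`: the entries of `p = (a₁, …, a_d)` satisfy `a_i ∈ C^{≤ α_i}` for some numbers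
`α₁, …, α_d` with `α₁ + ⋯ + α_d = α`. -/
inductive Level {R : Type u} [Semiring R] [∀ X Y, AddCommMonoid (C X Y)]
    [∀ X Y, Module R (C X Y)] (F : ∀ X Y : Ob, ℝ → Submodule R (C X Y)) :
    ∀ {X Y : Ob}, Path C X Y → ℝ → Prop
  | nil (X : Ob) : Level F (Path.nil X) 0
  | cons {X Y Z : Ob} {a : C X Y} {p : Path C Y Z} {α β : ℝ} (ha : a ∈ F X Y α)
      (hp : Level F p β) : Level F (Path.cons a p) (α + β)

theorem append_assoc {X Y Z W : Ob} (p : Path C X Y) (q : Path C Y Z) (s : Path C Z W) :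
    (p.append q).append s = p.append (q.append s) := by
  induction p with
  | nil => rfl
  | cons a p ih => simp only [append, ih]

theorem sumSplit_add {G : Type*} [AddCommMonoid G] {X Y : Ob} (p : Path C X Y)
    (F F' : ∀ Z : Ob, Path C X Z → Path C Z Y → G) :
    p.sumSplit (fun Z q s => F Z q s + F' Z q s) = p.sumSplit F + p.sumSplit F' := by
  induction p with
  | nil => rfl
  | cons a p ih => simp only [sumSplit, ih]; abel

theorem fst_sumSplit {G H : Type*} [AddCommMonoid G] [AddCommMonoid H] {X Y : Ob}
    (p : Path C X Y) (F : ∀ Z : Ob, Path C X Z → Path C Z Y → G × H) :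
    (p.sumSplit F).1 = p.sumSplit (fun Z q s => (F Z q s).1) := by
  induction p with
  | nil => rfl
  | cons a p ih => simp only [sumSplit, Prod.fst_add, ih]

theorem snd_sumSplit {G H : Type*} [AddCommMonoid G] [AddCommMonoid H] {X Y : Ob}
    (p : Path C X Y) (F : ∀ Z : Ob, Path C X Z → Path C Z Y → G × H) :
    (p.sumSplit F).2 = p.sumSplit (fun Z q s => (F Z q s).2) := by
  induction p with
  | nil => rfl
  | cons a p ih => simp only [sumSplit, Prod.snd_add, ih]

theorem sumSplit_append_single {G : Type*} [AddCommMonoid G] {X Y Z : Ob} (p : Path C X Y)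
    (b : C Y Z) (F : ∀ W : Ob, Path C X W → Path C W Z → G) :
    (p.append (single b)).sumSplit F =
      p.sumSplit (fun W q s => F W q (s.append (single b)))
        + F Z (p.append (single b)) (nil Z) := by
  induction p with
  | nil => rfl
  | cons a p ih => simp only [append, sumSplit, ih, add_assoc]

end Path

/-! ### `A_∞`-categories, modules and module homomorphisms, ungraded, over rings with `2 = 0` -/

/-- An (ungraded) `A_∞`-category over a ring `R` of characteristic `2`. `mu p` is
`μ_d(a₁, …, a_d)` for `p = (a₁, …, a_d)`; there is no operation `μ₀`, which is expressed by
giving it the value `0`. -/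
structure AInfCat (R : Type u) [CommRing R] where
  Ob : Type w
  Hom : Ob → Ob → Type v
  [addCommGroup : ∀ X Y, AddCommGroup (Hom X Y)]
  [module : ∀ X Y, Module R (Hom X Y)]
  mu : ∀ {X Y : Ob}, Path Hom X Y → Hom X Y
  mu_nil : ∀ X : Ob, mu (Path.nil X) = 0
  mu_add : ∀ {X Y Z W : Ob} (p : Path Hom X Y) (a b : Hom Y Z) (q : Path Hom Z W),
    mu (p.append (.cons (a + b) q)) = mu (p.append (.cons a q)) + mu (p.append (.cons b q))
  mu_smul : ∀ {X Y Z W : Ob} (p : Path Hom X Y) (t : R) (a : Hom Y Z) (q : Path Hom Z W),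
    mu (p.append (.cons (t • a) q)) = t • mu (p.append (.cons a q))
  /-- The `A_∞`-relations `∑ μ(a₁, …, μ(a_{i+1}, …, a_{i+j}), …, a_d) = 0`. -/
  rel : ∀ {X Y : Ob} (p : Path Hom X Y),
    p.sumSplit₃ (fun _ _ q t s => mu (q.append (.cons (mu t) s))) = 0

attribute [instance] AInfCat.addCommGroup AInfCat.module

/-- An `A_∞`-category whose morphism spaces carry increasing filtrations by `R`-submodules;
`filt X Y α` is `C^{≤ α}(X, Y)`. -/
structure FiltCat (R : Type u) [CommRing R] extends AInfCat.{u, v, w} R where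
  filt : ∀ X Y : Ob, ℝ → Submodule R (Hom X Y)
  filt_mono : ∀ X Y : Ob, Monotone (filt X Y)

variable {R : Type u} [CommRing R]

/-- `ε = (ε₁, ε₂, …)` is a sequence of non-negative numbers (the value `ε 0` is not used). -/
def NonnegSeq (ε : ℕ → ℝ) : Prop := ∀ d, 1 ≤ d → 0 ≤ ε d

/-- `A` is a weakly filtered `A_∞`-category with discrepancy `≤ ε`. -/
def FiltCat.HasDiscrepancy (A : FiltCat.{u, v, w} R) (ε : ℕ → ℝ) : Prop :=
  NonnegSeq ε ∧ ε 1 = 0 ∧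
    ∀ {X Y : A.Ob} (p : Path A.Hom X Y) (α : ℝ), 1 ≤ p.length → p.Level A.filt α →
      A.mu p ∈ A.filt X Y (α + ε p.length)

/-- An `A_∞`-module over `A` with an increasing filtration of each of its values;
`act p m` is `μ_d(a₁, …, a_{d-1}, m)` for `p = (a₁, …, a_{d-1})`, so that `act (nil X)` is the
differential of `carrier X`. -/
structure FiltModule (A : FiltCat.{u, v, w} R) where
  carrier : A.Ob → Type v
  [addCommGroup : ∀ X, AddCommGroup (carrier X)]
  [module : ∀ X, Module R (carrier X)]
  act : ∀ {X Y : A.Ob}, Path A.Hom X Y → carrier Y →ₗ[R] carrier X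
  act_add : ∀ {X Y Z W : A.Ob} (p : Path A.Hom X Y) (a b : A.Hom Y Z) (q : Path A.Hom Z W),
    act (p.append (.cons (a + b) q)) = act (p.append (.cons a q)) + act (p.append (.cons b q))
  act_smul : ∀ {X Y Z W : A.Ob} (p : Path A.Hom X Y) (t : R) (a : A.Hom Y Z)
    (q : Path A.Hom Z W), act (p.append (.cons (t • a) q)) = t • act (p.append (.cons a q))
  /-- The `A_∞`-relations of a module. -/
  rel : ∀ {X Y : A.Ob} (p : Path A.Hom X Y) (m : carrier Y),
    p.sumSplit (fun _ q s => act q (act s m)) +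
      p.sumSplit₃ (fun _ _ q t s => act (q.append (.cons (A.mu t) s)) m) = 0
  filt : ∀ X : A.Ob, ℝ → Submodule R (carrier X)
  filt_mono : ∀ X : A.Ob, Monotone (filt X)

attribute [instance] FiltModule.addCommGroup FiltModule.module

namespace FiltModule

variable {A : FiltCat.{u, v, w} R}

/-- The differential `μ₁` of `M(X)`. -/
def d (M : FiltModule A) (X : A.Ob) : M.carrier X →ₗ[R] M.carrier X := M.act (.nil X)

/-- `M` is a weakly filtered module with discrepancy `≤ ε`. -/
def HasDiscrepancy (M : FiltModule A) (ε : ℕ → ℝ) : Prop :=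
  NonnegSeq ε ∧ ε 1 = 0 ∧
    ∀ {X Y : A.Ob} (p : Path A.Hom X Y) (m : M.carrier Y) (α β : ℝ),
      p.Level A.filt α → m ∈ M.filt Y β → M.act p m ∈ M.filt X (α + β + ε (p.length + 1))

end FiltModule

/-- Module homomorphisms: pre-module homomorphisms `f = (f₁, f₂, …)` that are cycles of the
differential `μ₁^mod` (in characteristic `2`, without signs). `map p m` is
`f_d(a₁, …, a_{d-1}, m)` for `p = (a₁, …, a_{d-1})`. -/
structure ModHom {A : FiltCat.{u, v, w} R} (M N : FiltModule A) where
  map : ∀ {X Y : A.Ob}, Path A.Hom X Y → M.carrier Y →ₗ[R] N.carrier X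
  map_add : ∀ {X Y Z W : A.Ob} (p : Path A.Hom X Y) (a b : A.Hom Y Z) (q : Path A.Hom Z W),
    map (p.append (.cons (a + b) q)) = map (p.append (.cons a q)) + map (p.append (.cons b q))
  map_smul : ∀ {X Y Z W : A.Ob} (p : Path A.Hom X Y) (t : R) (a : A.Hom Y Z)
    (q : Path A.Hom Z W), map (p.append (.cons (t • a) q)) = t • map (p.append (.cons a q))
  cycle : ∀ {X Y : A.Ob} (p : Path A.Hom X Y) (m : M.carrier Y),
    p.sumSplit (fun _ q s => N.act q (map s m)) + p.sumSplit (fun _ q s => map q (M.act s m)) +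
      p.sumSplit₃ (fun _ _ q t s => map (q.append (.cons (A.mu t) s)) m) = 0

namespace ModHom

variable {A : FiltCat.{u, v, w} R} {M N : FiltModule A}

/-- The first order part `f₁ : M(X) → N(X)`. -/
def first (f : ModHom M N) (X : A.Ob) : M.carrier X →ₗ[R] N.carrier X := f.map (.nil X)

/-- `f` shifts action by `≤ ρ` and has discrepancy `≤ ε`. -/
def Shifts (f : ModHom M N) (ρ : ℝ) (ε : ℕ → ℝ) : Prop :=
  NonnegSeq ε ∧
    ∀ {X Y : A.Ob} (p : Path A.Hom X Y) (m : M.carrier Y) (α β : ℝ),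
      p.Level A.filt α → m ∈ M.filt Y β →
        f.map p m ∈ N.filt X (α + β + ρ + ε (p.length + 1))

/-- `f` is a quasi-isomorphism: each `f₁ : M(X) → N(X)` induces an injective and surjective map
in homology. -/
def IsQuasiIso (f : ModHom M N) : Prop :=
  ∀ X : A.Ob,
    (∀ m : M.carrier X, M.d X m = 0 → (∃ n : N.carrier X, f.first X m = N.d X n) →
      ∃ m' : M.carrier X, m = M.d X m') ∧
    (∀ n : N.carrier X, N.d X n = 0 →
      ∃ m : M.carrier X, M.d X m = 0 ∧ ∃ n' : N.carrier X, f.first X m = n + N.d X n')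

end ModHom

/-! ### Yoneda modules and mapping cones -/

/-- `b ↦ μ_d(a₁, …, a_{d-1}, b)` for `p = (a₁, …, a_{d-1})`. -/
def yonedaAct (A : FiltCat.{u, v, w} R) (L : A.Ob) {X Y : A.Ob} (p : Path A.Hom X Y) :
    A.Hom Y L →ₗ[R] A.Hom X L where
  toFun b := A.mu (p.append (.single b))
  map_add' a b := A.mu_add p a b (.nil L)
  map_smul' t a := A.mu_smul p t a (.nil L)

theorem yonedaAct_apply (A : FiltCat.{u, v, w} R) (L : A.Ob) {X Y : A.Ob} (p : Path A.Hom X Y)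
    (b : A.Hom Y L) : yonedaAct A L p b = A.mu (p.append (.single b)) := rfl

/-- The Yoneda module of `L`: `X ↦ C(X, L)`, with the operations and filtrations of `A`. -/
def yoneda (A : FiltCat.{u, v, w} R) (L : A.Ob) : FiltModule A where
  carrier X := A.Hom X L
  act p := yonedaAct A L p
  act_add p a b q := by
    ext c
    simpa only [yonedaAct_apply, LinearMap.add_apply, Path.append_assoc, Path.append]
      using A.mu_add p a b (q.append (.single c))
  act_smul p t a q := by
    ext c
    simpa only [yonedaAct_apply, LinearMap.smul_apply, Path.append_assoc, Path.append]
      using A.mu_smul p t a (q.append (.single c))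
  rel p b := by
    have h := A.rel (p.append (.single b))
    have h0 : A.mu ((p.append (.single b)).append (.cons (A.mu (.nil L)) (.nil L))) = 0 := by
      rw [A.mu_nil]
      simpa using A.mu_smul (p.append (.single b)) 0 0 (.nil L)
    simp only [Path.sumSplit₃, Path.sumSplit_append_single, Path.sumSplit_add] at h
    simp only [Path.sumSplit] at h
    rw [h0, add_zero, add_comm] at h
    simpa only [Path.sumSplit₃, yonedaAct_apply, Path.append_assoc, Path.append, Path.single]
      using h
  filt X := A.filt X L
  filt_mono X := A.filt_mono X L

/-- The weakly filtered mapping cone `Cone(f; ρ, ε)` of `f : M → N`, with underlying modules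
`M(X) ⊕ N(X)` and filtration `M^{≤ α - ρ - ε₁}(X) ⊕ N^{≤ α}(X)`. -/
def cone {A : FiltCat.{u, v, w} R} {M N : FiltModule A} (f : ModHom M N) (ρ : ℝ) (ε : ℕ → ℝ) :
    FiltModule A where
  carrier X := M.carrier X × N.carrier X
  act p := ((M.act p).comp (LinearMap.fst R _ _)).prod
    ((f.map p).comp (LinearMap.fst R _ _) + (N.act p).comp (LinearMap.snd R _ _))
  act_add p a b q := by
    ext x <;> simp [M.act_add, N.act_add, f.map_add]
  act_smul p t a q := by
    ext x <;> simp [M.act_smul, N.act_smul, f.map_smul]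
  rel p m := by
    obtain ⟨x, y⟩ := m
    have hM := M.rel p x
    have hN := N.rel p y
    have hf := f.cycle p x
    simp only [Path.sumSplit₃] at hM hN hf ⊢
    refine Prod.ext ?_ ?_
    · simpa only [Prod.fst_add, Prod.fst_zero, Path.fst_sumSplit, LinearMap.prod_apply,
        Function.prod_apply, LinearMap.comp_apply, LinearMap.fst_apply] using hM
    · simp only [Prod.snd_add, Prod.snd_zero, Path.snd_sumSplit, LinearMap.prod_apply,
        Function.prod_apply, LinearMap.comp_apply, LinearMap.fst_apply, LinearMap.snd_apply,
        LinearMap.add_apply, map_add, Path.sumSplit_add]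
      calc _ = _ := by abel
        _ = (0 : N.carrier _) + 0 := congrArg₂ (· + ·) hf hN
        _ = 0 := add_zero 0
  filt X α := (M.filt X (α - ρ - ε 1)).prod (N.filt X α)
  filt_mono X := fun α β h => Submodule.prod_mono
    (M.filt_mono X (by linarith)) (N.filt_mono X h)

/-! ### Unitality -/

/-- `A` is h-unital in the weakly filtered sense, with the cycles `e X ∈ C^{≤ u}(X, X)`
representing the (two-sided) units in homology. -/
structure HUnital (A : FiltCat.{u, v, w} R) (e : ∀ X : A.Ob, A.Hom X X) (uA : ℝ) : Prop where
  nonneg : 0 ≤ uA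
  mem : ∀ X, e X ∈ A.filt X X uA
  cycle : ∀ X, A.mu (.single (e X)) = 0
  left_unit : ∀ {X Y : A.Ob} (b : A.Hom X Y), A.mu (.single b) = 0 →
    ∃ c : A.Hom X Y, A.mu (.cons (e X) (.single b)) = b + A.mu (.single c)
  right_unit : ∀ {X Y : A.Ob} (b : A.Hom X Y), A.mu (.single b) = 0 →
    ∃ c : A.Hom X Y, A.mu (.cons b (.single (e Y))) = b + A.mu (.single c)

/-- Assumption `U^e(ζ)`: `μ₂(e_X, e_X) = e_X + μ₁(c)` for some `c ∈ C^{≤ ζ}(X, X)`. -/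
def AssumptionUe (A : FiltCat.{u, v, w} R) (e : ∀ X : A.Ob, A.Hom X X) (ζ : ℝ) : Prop :=
  ∀ X : A.Ob, ∃ c ∈ A.filt X X ζ,
    A.mu (.cons (e X) (.single (e X))) = e X + A.mu (.single c)

/-- Assumption `U^{R,e}(κ)` for an object `Y`: each map `b ↦ μ₂(b, e_Y)` on `C(X, Y)` is chain
homotopic to the identity through a chain homotopy that shifts action by `≤ κ`. -/
def AssumptionURe (A : FiltCat.{u, v, w} R) (e : ∀ X : A.Ob, A.Hom X X) (Y : A.Ob) (κ : ℝ) :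
    Prop :=
  ∀ X : A.Ob, ∃ h : A.Hom X Y →ₗ[R] A.Hom X Y,
    (∀ α : ℝ, ∀ b ∈ A.filt X Y α, h b ∈ A.filt X Y (α + κ)) ∧
    ∀ b : A.Hom X Y,
      A.mu (.cons b (.single (e Y))) = b + h (A.mu (.single b)) + A.mu (.single (h b))

/-- Assumption `U_w(κ)` for a module `M`: the maps `M^{≤ α}(X) → M^{≤ α + κ}(X)`,
`b ↦ μ₂(e_X, b)`, are well defined and induce the same maps in homology as the inclusions. -/
def AssumptionUw {A : FiltCat.{u, v, w} R} (e : ∀ X : A.Ob, A.Hom X X) (M : FiltModule A)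
    (κ : ℝ) : Prop :=
  ∀ (X : A.Ob) (α : ℝ),
    (∀ b ∈ M.filt X α, b ∈ M.filt X (α + κ) ∧ M.act (.single (e X)) b ∈ M.filt X (α + κ)) ∧
    ∀ b ∈ M.filt X α, M.d X b = 0 →
      ∃ c ∈ M.filt X (α + κ), M.act (.single (e X)) b = b + M.d X c

/-! ### Modules split into pieces and iterated cones -/

/-- A filtered module together with an identification, as `R`-modules, of each `M(X)` with
`C(X, L₀) ⊕ ⋯ ⊕ C(X, L_n)`. -/
structure SplitModule (A : FiltCat.{u, v, w} R) (L : ℕ → A.Ob) (n : ℕ) where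
  mod : FiltModule A
  split : ∀ X : A.Ob, mod.carrier X ≃ₗ[R] (∀ i : Fin (n + 1), A.Hom X (L i))

namespace SplitModule

variable {A : FiltCat.{u, v, w} R} {L : ℕ → A.Ob} {n : ℕ}

/-- The inclusion of the summand `C(X, L_j)` in `M(X)`. -/
def incl (M : SplitModule A L n) (X : A.Ob) (j : Fin (n + 1)) :
    A.Hom X (L j) →ₗ[R] M.mod.carrier X :=
  (M.split X).symm.toLinearMap.comp (LinearMap.single R (fun i : Fin (n + 1) => A.Hom X (L i)) j)

/-- The projection of `M(X)` to the summand `C(X, L_i)`. -/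
def proj (M : SplitModule A L n) (X : A.Ob) (i : Fin (n + 1)) :
    M.mod.carrier X →ₗ[R] A.Hom X (L i) :=
  (LinearMap.proj (R := R) (φ := fun i : Fin (n + 1) => A.Hom X (L i)) i).comp
    (M.split X).toLinearMap

/-- The `(i, j)` entry `C(X, L_j) → C(X, L_i)` of the matrix of a linear map `M(X) → N(X)`. -/
def entry (M N : SplitModule A L n) (X : A.Ob) (T : M.mod.carrier X →ₗ[R] N.mod.carrier X)
    (i j : Fin (n + 1)) : A.Hom X (L j) →ₗ[R] A.Hom X (L i) :=
  (N.proj X i).comp (T.comp (M.incl X j))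

/-- The Yoneda module of `L₀`, with its single piece. -/
def base (A : FiltCat.{u, v, w} R) (L : ℕ → A.Ob) : SplitModule A L 0 where
  mod := yoneda A (L 0)
  split X :=
    { toFun := fun b i => Fin.cases (motive := fun i : Fin 1 => A.Hom X (L i)) b
        (fun k => k.elim0) i
      invFun := fun x => x 0
      map_add' := fun a b => by
        funext i
        fin_cases i
        rfl
      map_smul' := fun t a => by
        funext i
        fin_cases i
        rfl
      left_inv := fun b => rfl
      right_inv := fun x => by
        funext i
        fin_cases i
        rfl }

/-- A finite family as its last member together with the remaining ones. -/
def snocLinear {R : Type u} [CommRing R] {n : ℕ} (V : Fin (n + 1) → Type v)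
    [∀ i, AddCommGroup (V i)] [∀ i, Module R (V i)] :
    (V (Fin.last n) × (∀ i : Fin n, V i.castSucc)) ≃ₗ[R] (∀ i, V i) where
  toFun x := Fin.snoc (α := V) x.2 x.1
  invFun y := (y (Fin.last n), fun i => y i.castSucc)
  map_add' x y := by
    funext i
    refine Fin.lastCases ?_ (fun k => ?_) i <;> simp
  map_smul' t x := by
    funext i
    refine Fin.lastCases ?_ (fun k => ?_) i <;> simp
  left_inv x := by simp
  right_inv y := by
    funext i
    refine Fin.lastCases ?_ (fun k => ?_) i <;> simp

/-- The weakly filtered cone of `φ : Yoneda(L_{n+1}) → K`; its pieces are those of `K` and, as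
the last one, `C(X, L_{n+1})`. -/
def step (K : SplitModule A L n) (φ : ModHom (yoneda A (L (n + 1))) K.mod) (ρ : ℝ)
    (δ : ℕ → ℝ) : SplitModule A L (n + 1) where
  mod := cone φ ρ δ
  split X :=
    ((LinearEquiv.refl R (A.Hom X (L (n + 1)))).prodCongr (K.split X)).trans
      (snocLinear (R := R) (fun i : Fin (n + 2) => A.Hom X (L i)))

end SplitModule

/-- `IsIteratedCone ρ δ n K`: `K` is a weakly filtered iterated cone `K_n`, where `K₀` is the
Yoneda module of `L₀` and `K_{i+1} = Cone(φ_{i+1}; ρ_{i+1}, δ_{i+1})` for a module homomorphism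
`φ_{i+1} : Yoneda(L_{i+1}) → K_i` that shifts action by `≤ ρ_{i+1}` and has discrepancy
`≤ δ_{i+1}`. -/
inductive IsIteratedCone {A : FiltCat.{u, v, w} R} {L : ℕ → A.Ob} (ρ : ℕ → ℝ)
    (δ : ℕ → ℕ → ℝ) : ∀ n : ℕ, SplitModule A L n → Prop
  | base : IsIteratedCone ρ δ 0 (SplitModule.base A L)
  | step {n : ℕ} {K : SplitModule A L n} (hK : IsIteratedCone ρ δ n K)
      (φ : ModHom (yoneda A (L (n + 1))) K.mod) (hφ : φ.Shifts (ρ (n + 1)) (δ (n + 1))) :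
      IsIteratedCone ρ δ (n + 1) (K.step φ (ρ (n + 1)) (δ (n + 1)))

/-! ### The quantities in the estimates -/

/-- `χ_{m,d} = ∑_{j=1}^m ∑_{i=1}^{d+m} δ_i^{φ_j} + ∑_{i=1}^{d+m} ε_i`. -/
noncomputable def chi (ε : ℕ → ℝ) (δ : ℕ → ℕ → ℝ) (m d : ℕ) : ℝ :=
  ∑ j ∈ Finset.Icc 1 m, ∑ i ∈ Finset.Icc 1 (d + m), δ j i + ∑ i ∈ Finset.Icc 1 (d + m), ε i

/-- `ξ_q = κ + ∑_{i=1}^{q+3} ε_i + ∑_{j=1}^q ∑_{i=1}^{q+2} δ_i^{φ_j}`. -/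
noncomputable def xi (κ : ℝ) (ε : ℕ → ℝ) (δ : ℕ → ℕ → ℝ) (q : ℕ) : ℝ :=
  κ + ∑ i ∈ Finset.Icc 1 (q + 3), ε i +
    ∑ j ∈ Finset.Icc 1 q, ∑ i ∈ Finset.Icc 1 (q + 2), δ j i

/-- For `l = [k_{d-1}, …, k₂]` the composable tuple
`(c_{j,k_{d-1}}, c_{k_{d-1},k_{d-2}}, …, c_{k₂,i})` from `L_j` to `L_i`. -/
def chainPath {Ob : Type w} {C : Ob → Ob → Type v} {L : ℕ → Ob} (c : ∀ q p : ℕ, C (L q) (L p)) :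
    (j : ℕ) → List ℕ → (i : ℕ) → Path C (L j) (L i)
  | j, [], i => .single (c j i)
  | j, k :: l, i => .cons (c j k) (chainPath c k l i)

/-- `∑ μ_d(b, c_{k_d,k_{d-1}}, …, c_{k₂,k₁})` over all `d ≥ 2` and all
`i = k₁ < k₂ < ⋯ < k_d = j`; such a sequence is given by the subset `{k₂, …, k_{d-1}}` of the
open interval `(i, j)`. -/
noncomputable def chainSum {A : FiltCat.{u, v, w} R} {L : ℕ → A.Ob}
    (c : ∀ q p : ℕ, A.Hom (L q) (L p)) (i j : ℕ) {X : A.Ob} (b : A.Hom X (L j)) : A.Hom X (L i) :=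
  ∑ s ∈ (Finset.Ioo i j).powerset,
    A.mu (.cons b (chainPath c j (s.sort (· ≥ ·)) i))

end WeaklyFiltered

open WeaklyFiltered

/-! The cones are reduced one at a time by a Yoneda argument. For a cycle c ∈ M(L) let λ(c) be the
homomorphism μ(…, -, c) from the Yoneda module of L to M. Given φ from the Yoneda module of L to N,
inserting the unit e into the last slot of φ is a homotopy between φ ∘ λ(e) and λ(φ₁(e))
(`ModHom.diff_insert`). If h is the homotopy of U^{R,e}, then λ(e) + μ₁^mod(h) is an endomorphism
homotopic to λ(e) whose first order part is exactly the identity (`unitEnd_first`).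

Suppose K_n already receives a homomorphism τ : red → K_n with τ₁ bijective, where red is an
iterated cone over homomorphisms λ(c). For φ with values in K_n put c = τ₁⁻¹(φ₁(e)). Insertion of c
into τ, insertion of e into φ, and φ ∘ h add up to a homotopy between τ ∘ λ(c) and φ ∘ (λ(e) +
μ₁^mod(h)) (`unitHtpy_diff`), hence define a homomorphism Cone(λ(c)) → Cone(φ) (`ModHom.coneMap`).
Its first order part is triangular with diagonal blocks id and τ₁, so it is again bijective. The
components of c are the new elements c_{n+1,p}, and expanding c in the operations of red yields the
sums over chains (`Reduction.proj_act_vec`).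

For the estimates, the new piece of red is shifted by ρ_{n+1} + 2^n ξ_{n+1}. This is enough to
absorb the level of c and the homotopy, so τ₁ stays filtered; the price is paid by τ₁⁻¹, whose shift
grows from (2^n - 1) ξ_n to at most (2^{n+1} - 1) ξ_{n+1} (`Reduction.step`).

The conclusion prescribes only the differential and the filtration of M. So M takes these from red,
while its higher operations are those of K conjugated by τ₁. Then σ = τ₁⁻¹ is a strict homomorphism
without discrepancy, and no inverse of τ as an A_∞-homomorphism is needed. -/

namespace WeaklyFiltered

/-! ### Decompositions and filtration levels of composable tuples -/

namespace Path

variable {Ob : Type w} {C : Ob → Ob → Type v}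

theorem map_sumSplit {G H T : Type*} [AddCommMonoid G] [AddCommMonoid H] [FunLike T G H]
    [AddMonoidHomClass T G H] (g : T) {X Y : Ob} (p : Path C X Y)
    (F : ∀ Z : Ob, Path C X Z → Path C Z Y → G) :
    g (p.sumSplit F) = p.sumSplit fun Z q s => g (F Z q s) := by
  induction p with
  | nil => rfl
  | cons a p ih => simp only [sumSplit, map_add, ih]

theorem sumSplit_zero {G : Type*} [AddCommMonoid G] {X Y : Ob} (p : Path C X Y) :
    p.sumSplit (fun _ _ _ => (0 : G)) = 0 := by
  induction p with
  | nil => rfl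
  | cons a p ih => simp only [sumSplit, ih, add_zero]

/-- A sum over decompositions whose terms vanish unless the first piece is empty. -/
theorem sumSplit_eq_nil_left {G : Type*} [AddCommMonoid G] {X Y : Ob} (p : Path C X Y)
    (F : ∀ Z : Ob, Path C X Z → Path C Z Y → G)
    (hF : ∀ (W Z : Ob) (a : C X W) (q : Path C W Z) (s : Path C Z Y), F Z (cons a q) s = 0) :
    p.sumSplit F = F X (nil X) p := by
  cases p with
  | nil => rfl
  | cons a p => simp only [sumSplit, hF, sumSplit_zero, add_zero]

/-- A sum over decompositions whose terms vanish unless the second piece is empty. -/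
theorem sumSplit_eq_nil_right {G : Type*} [AddCommMonoid G] {X Y : Ob} (p : Path C X Y)
    (F : ∀ Z : Ob, Path C X Z → Path C Z Y → G)
    (hF : ∀ (W Z : Ob) (q : Path C X Z) (a : C Z W) (s : Path C W Y), F Z q (cons a s) = 0) :
    p.sumSplit F = F Y p (nil Y) := by
  induction p with
  | nil => rfl
  | cons a p ih =>
    rw [sumSplit, hF, zero_add]
    exact ih (fun Z q s => F Z (cons a q) s) fun W Z q b s => hF W Z (cons a q) b s

theorem length_append {X Y Z : Ob} (p : Path C X Y) (q : Path C Y Z) :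
    (p.append q).length = p.length + q.length := by
  induction p with
  | nil => simp only [append, length, zero_add]
  | cons a p ih => simp only [append, length, ih]; omega

theorem length_append_single {X Y Z : Ob} (p : Path C X Y) (b : C Y Z) :
    (p.append (single b)).length = p.length + 1 := by
  rw [length_append]; rfl

theorem Level.append {R : Type u} [Semiring R] [∀ X Y, AddCommMonoid (C X Y)]
    [∀ X Y, Module R (C X Y)] {F : ∀ X Y : Ob, ℝ → Submodule R (C X Y)} {X Y Z : Ob}
    {p : Path C X Y} {q : Path C Y Z} {α β : ℝ} (hp : p.Level F α) (hq : q.Level F β) :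
    (p.append q).Level F (α + β) := by
  induction hp with
  | nil => simpa only [Path.append, zero_add] using hq
  | cons ha _ ih => rw [add_assoc]; exact .cons ha (ih hq)

theorem Level.single {R : Type u} [Semiring R] [∀ X Y, AddCommMonoid (C X Y)]
    [∀ X Y, Module R (C X Y)] {F : ∀ X Y : Ob, ℝ → Submodule R (C X Y)} {X Y : Ob}
    {b : C X Y} {β : ℝ} (hb : b ∈ F X Y β) : (Path.single b).Level F β := by
  have h := Level.cons hb (Level.nil (F := F) Y)
  rwa [add_zero] at h

theorem Level.append_single {R : Type u} [Semiring R] [∀ X Y, AddCommMonoid (C X Y)]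
    [∀ X Y, Module R (C X Y)] {F : ∀ X Y : Ob, ℝ → Submodule R (C X Y)} {X Y Z : Ob}
    {p : Path C X Y} {b : C Y Z} {α β : ℝ} (hp : p.Level F α) (hb : b ∈ F Y Z β) :
    (p.append (.single b)).Level F (α + β) := hp.append (.single hb)

end Path

variable {R : Type u} [CommRing R] {A : FiltCat.{u, v, w} R}

theorem add_self_of_two_eq_zero (h2 : (2 : R) = 0) {V : Type*} [AddCommGroup V] [Module R V]
    (x : V) : x + x = 0 := by
  rw [← two_smul R x, h2, zero_smul]

theorem eq_of_add_eq_zero (h2 : (2 : R) = 0) {V : Type*} [AddCommGroup V] [Module R V]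
    {x y : V} (h : x + y = 0) : x = y := by
  rw [← neg_eq_of_add_eq_zero_left (add_self_of_two_eq_zero h2 y)]
  exact eq_neg_of_add_eq_zero_left h

/-! ### Pre-module homomorphisms -/

/-- Pre-module homomorphisms `f = (f₁, f₂, …)`, without any condition on their differential. -/
structure PreHom (M N : FiltModule A) where
  map : ∀ {X Y : A.Ob}, Path A.Hom X Y → M.carrier Y →ₗ[R] N.carrier X
  map_add : ∀ {X Y Z W : A.Ob} (p : Path A.Hom X Y) (a b : A.Hom Y Z) (q : Path A.Hom Z W),
    map (p.append (.cons (a + b) q)) = map (p.append (.cons a q)) + map (p.append (.cons b q))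
  map_smul : ∀ {X Y Z W : A.Ob} (p : Path A.Hom X Y) (t : R) (a : A.Hom Y Z)
    (q : Path A.Hom Z W), map (p.append (.cons (t • a) q)) = t • map (p.append (.cons a q))

namespace PreHom

variable {M N P : FiltModule A}

/-- The differential `μ₁^mod` of a pre-module homomorphism. -/
def diff (f : PreHom M N) {X Y : A.Ob} (p : Path A.Hom X Y) (m : M.carrier Y) : N.carrier X :=
  p.sumSplit (fun _ q s => N.act q (f.map s m)) + p.sumSplit (fun _ q s => f.map q (M.act s m)) +
    p.sumSplit₃ (fun _ _ q t s => f.map (q.append (.cons (A.mu t) s)) m)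

/-- The sum of two pre-module homomorphisms. -/
def add (f g : PreHom M N) : PreHom M N where
  map p := f.map p + g.map p
  map_add p a b q := by rw [f.map_add, g.map_add]; abel
  map_smul p t a q := by rw [f.map_smul, g.map_smul, smul_add]

theorem diff_add (f g : PreHom M N) {X Y : A.Ob} (p : Path A.Hom X Y) (m : M.carrier Y) :
    (f.add g).diff p m = f.diff p m + g.diff p m := by
  simp only [diff, add, LinearMap.add_apply, _root_.map_add, Path.sumSplit_add, Path.sumSplit₃]
  abel

/-- The pre-module homomorphism `(a₁, …, a_{d-1}, b) ↦ f_{d+1}(a₁, …, a_{d-1}, b, c)` on a Yoneda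
module. -/
def insert (f : PreHom M N) {L : A.Ob} (c : M.carrier L) : PreHom (yoneda A L) N where
  map {X Y} p :=
    { toFun := fun b : A.Hom Y L => f.map (p.append (.single b)) c
      map_add' := fun a b => congrArg (fun g => g c) (f.map_add p a b (.nil L))
      map_smul' := fun t a => congrArg (fun g => g c) (f.map_smul p t a (.nil L)) }
  map_add p a b q := by
    ext x
    have h := congrArg (fun g => g c) (f.map_add p a b (q.append (.single (C := A.Hom) x)))
    simp only [LinearMap.coe_mk, Path.append_assoc, Path.append]
    exact h
  map_smul p t a q := by
    ext x
    have h := congrArg (fun g => g c) (f.map_smul p t a (q.append (.single (C := A.Hom) x)))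
    simp only [LinearMap.coe_mk, Path.append_assoc, Path.append]
    exact h

/-- The composition of a pre-module homomorphism with linear maps `h : P(X) → M(X)`. -/
def precomp (f : PreHom M N) (h : ∀ X, P.carrier X →ₗ[R] M.carrier X) : PreHom P N where
  map {_ Y} p := (f.map p).comp (h Y)
  map_add p a b q := by rw [f.map_add, LinearMap.add_comp]
  map_smul p t a q := by rw [f.map_smul, LinearMap.smul_comp]

/-- The composition of linear maps `h : N(X) → P(X)` with a pre-module homomorphism. -/
def postcomp (f : PreHom M N) (h : ∀ X, N.carrier X →ₗ[R] P.carrier X) : PreHom M P where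
  map {X _} p := (h X).comp (f.map p)
  map_add p a b q := by rw [f.map_add, LinearMap.comp_add]
  map_smul p t a q := by rw [f.map_smul, LinearMap.comp_smul]

theorem map_cons_zero (f : PreHom M N) {X Y Z W : A.Ob} (p : Path A.Hom X Y)
    (q : Path A.Hom Z W) : f.map (p.append (.cons (0 : A.Hom Y Z) q)) = 0 := by
  simpa only [zero_smul] using f.map_smul p 0 (0 : A.Hom Y Z) q

/-- The triple sum in the differential along a tuple with a last entry `b`. -/
theorem sumSplit₃_append_single (f : PreHom M N) {X Y L : A.Ob} (p : Path A.Hom X Y)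
    (b : A.Hom Y L) (c : M.carrier L) :
    (p.append (.single b)).sumSplit₃ (fun _ _ q t s => f.map (q.append (.cons (A.mu t) s)) c) =
      p.sumSplit₃ (fun _ _ q t s =>
        f.map ((q.append (.cons (A.mu t) s)).append (.single b)) c) +
      p.sumSplit (fun _ q s => f.map (q.append (.single (A.mu (s.append (.single b))))) c) := by
  simp only [Path.append_assoc, Path.append]
  simp only [Path.sumSplit₃, Path.sumSplit_append_single, Path.sumSplit_add]
  -- The remaining decomposition has an empty middle piece after b and contributes μ₀ = 0.
  simp only [Path.sumSplit, A.mu_nil, map_cons_zero, LinearMap.zero_apply, add_zero]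
  rfl

end PreHom

/-- The operations of a module as a pre-module endomorphism of it. -/
def FiltModule.actPre (M : FiltModule A) : PreHom M M where
  map := M.act
  map_add := M.act_add
  map_smul := M.act_smul

/-! ### Module homomorphisms as cycles, and the homomorphisms λ(c) -/

namespace ModHom

variable {M N : FiltModule A}

/-- The underlying pre-module homomorphism. -/
def toPre (f : ModHom M N) : PreHom M N where
  map := f.map
  map_add := f.map_add
  map_smul := f.map_smul

/-- A pre-module homomorphism which is a cycle. -/
def ofPre (f : PreHom M N)
    (hf : ∀ {X Y : A.Ob} (p : Path A.Hom X Y) (m : M.carrier Y), f.diff p m = 0) :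
    ModHom M N where
  map := f.map
  map_add := f.map_add
  map_smul := f.map_smul
  cycle := hf

theorem diff_toPre (f : ModHom M N) {X Y : A.Ob} (p : Path A.Hom X Y) (m : M.carrier Y) :
    f.toPre.diff p m = 0 := f.cycle p m

/-- The first order part of a module homomorphism is a chain map, up to sign. -/
theorem d_first_add (f : ModHom M N) (X : A.Ob) (m : M.carrier X) :
    N.d X (f.first X m) + f.first X (M.d X m) = 0 := by
  have h := f.cycle (.nil X) m
  have h0 : f.map (.cons (A.mu (.nil X)) (.nil X)) = 0 := by
    rw [A.mu_nil]; exact f.toPre.map_cons_zero (.nil X) (.nil X)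
  simp only [Path.sumSplit₃, Path.sumSplit, Path.append, h0, LinearMap.zero_apply, add_zero] at h
  exact h

theorem d_first (h2 : (2 : R) = 0) (f : ModHom M N) (X : A.Ob) (m : M.carrier X) :
    N.d X (f.first X m) = f.first X (M.d X m) :=
  eq_of_add_eq_zero h2 (f.d_first_add X m)

end ModHom

/-- The module homomorphism `(a₁, …, a_{d-1}, b) ↦ μ_{d+1}(a₁, …, a_{d-1}, b, c)` from a Yoneda
module to `M` defined by a cycle `c ∈ M(L)`. -/
def FiltModule.lambda (M : FiltModule A) {L : A.Ob} (c : M.carrier L) (hc : M.d L c = 0) :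
    ModHom (yoneda A L) M :=
  .ofPre (M.actPre.insert c) fun {X Y} p (b : A.Hom Y L) => by
    -- The module relation for (a₁, …, a_{d-1}, b, c) is the cycle equation for λ(c), apart from the
    -- term containing μ₁(c) = 0.
    have h := M.rel (p.append (.single b)) c
    have h3 := M.actPre.sumSplit₃_append_single p b c
    have h0 : M.act (.nil L) c = 0 := hc
    simp only [FiltModule.actPre] at h3
    rw [h3, Path.sumSplit_append_single, h0, map_zero, add_zero, add_comm (Path.sumSplit₃ p _),
      ← add_assoc] at h
    exact h

/-- Naturality of `lambda`: inserting a cycle `c` into `f` is a homotopy between `f ∘ λ(c)` and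
`λ(f₁(c))`. -/
theorem ModHom.diff_insert (h2 : (2 : R) = 0) {M N : FiltModule A} (f : ModHom M N) {L : A.Ob}
    (c : M.carrier L) (hc : M.d L c = 0) {X Y : A.Ob} (p : Path A.Hom X Y) (b : A.Hom Y L) :
    (f.toPre.insert c).diff p b =
      p.sumSplit (fun _ q s => f.map q (M.act (s.append (.single b)) c)) +
        N.act (p.append (.single b)) (f.first L c) := by
  have h := f.cycle (p.append (.single b)) c
  have h3 := f.toPre.sumSplit₃_append_single p b c
  have h0 : M.act (.nil L) c = 0 := hc
  simp only [ModHom.toPre] at h3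
  rw [h3, Path.sumSplit_append_single, Path.sumSplit_append_single, h0, map_zero, add_zero] at h
  have aux : ∀ x n y s t : N.carrier X, x + n + y + (s + t) = 0 → x + t + s = y + n :=
    fun x n y s t hx => eq_of_add_eq_zero h2 (Eq.trans (by abel) hx)
  exact aux _ _ _ _ _ h

/-! ### Homotopies, strict homomorphisms and maps of cones -/

namespace ModHom

variable {M N : FiltModule A}

/-- The differential of `f ∘ h`, for a module homomorphism `f` and linear maps `h`. -/
theorem diff_precomp (h2 : (2 : R) = 0) (f : ModHom M N)
    (h : ∀ X, M.carrier X →ₗ[R] M.carrier X) {X Y : A.Ob} (p : Path A.Hom X Y)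
    (m : M.carrier Y) :
    (f.toPre.precomp h).diff p m =
      p.sumSplit (fun Z q s => f.map q (M.act s (h Y m) + h Z (M.act s m))) := by
  have hc := f.cycle p (h Y m)
  have aux : ∀ x y s t : N.carrier X, x + y + s = 0 → x + t + s = y + t := fun x y s t hx => by
    rw [add_right_comm, eq_of_add_eq_zero h2 ((add_right_comm x s y).trans hx)]
  rw [show (fun Z q s => f.map q (M.act s (h Y m) + h Z (M.act s m))) = fun Z q s =>
    f.map q (M.act s (h Y m)) + f.map q (h Z (M.act s m)) from by simp only [_root_.map_add],
    Path.sumSplit_add]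
  exact aux _ _ _ _ hc

/-- The module endomorphism `μ₁^mod(h)` for linear maps `h : M(X) → M(X)`. -/
def commutator (h2 : (2 : R) = 0) (h : ∀ X, M.carrier X →ₗ[R] M.carrier X) : ModHom M M :=
  .ofPre ((M.actPre.precomp h).add (M.actPre.postcomp h)) fun {X Y} p m => by
    have h1 := M.rel p (h Y m)
    have h1' := congrArg (h X) (M.rel p m)
    -- Here z is the sum of the terms μ(…, h(μ(…, m))). It occurs once in the differential of μ ∘ h
    -- and once in that of h ∘ μ, so it cancels as 2 = 0; the rest is two module relations.
    have aux : ∀ x s y t z : M.carrier X, x + s = 0 → y + t = 0 →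
        x + z + (z + y) + (s + t) = 0 := fun x s y t z hx hy => by
      have hz := add_self_of_two_eq_zero h2 z
      calc x + z + (z + y) + (s + t) = (x + s) + (y + t) + (z + z) := by abel
        _ = 0 := by rw [hx, hy, hz, add_zero, add_zero]
    simp only [_root_.map_add, map_zero, Path.sumSplit₃, Path.map_sumSplit] at h1 h1'
    have h3 := aux _ _ _ _ (p.sumSplit fun Z q s => M.act q (h Z (M.act s m))) h1 h1'
    simp only [← Path.sumSplit_add] at h3
    simp only [PreHom.diff, PreHom.add, PreHom.precomp, PreHom.postcomp, FiltModule.actPre,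
      LinearMap.add_apply, LinearMap.comp_apply, _root_.map_add, Path.sumSplit₃,
      ← Path.sumSplit_add]
    exact h3

/-- The sum of two module homomorphisms. -/
def add (f g : ModHom M N) : ModHom M N :=
  .ofPre (f.toPre.add g.toPre) fun p m => by
    rw [PreHom.diff_add, diff_toPre, diff_toPre, add_zero]

theorem add_apply (f g : ModHom M N) {X Y : A.Ob} (p : Path A.Hom X Y) (m : M.carrier Y) :
    (f.add g).map p m = f.map p m + g.map p m := rfl

/-- The components of the strict module homomorphism with first order part `t`. -/
def strictMap (t : ∀ X, M.carrier X →ₗ[R] N.carrier X) :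
    ∀ {X Y : A.Ob}, Path A.Hom X Y → M.carrier Y →ₗ[R] N.carrier X
  | _, _, .nil X => t X
  | _, _, .cons _ _ => 0

theorem strictMap_append_cons (t : ∀ X, M.carrier X →ₗ[R] N.carrier X) {X Y Z W : A.Ob}
    (p : Path A.Hom X Y) (a : A.Hom Y Z) (q : Path A.Hom Z W) :
    strictMap t (p.append (.cons a q)) = 0 := by
  cases p <;> rfl

/-- The module homomorphism with first order part `t` and no higher order parts, for linear maps
`t` that commute with all operations. -/
def strict (h2 : (2 : R) = 0) (t : ∀ X, M.carrier X →ₗ[R] N.carrier X)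
    (ht : ∀ {X Y : A.Ob} (p : Path A.Hom X Y) (m : M.carrier Y),
      t X (M.act p m) = N.act p (t Y m)) : ModHom M N where
  map := strictMap t
  map_add p a b q := by simp only [strictMap_append_cons, add_zero]
  map_smul p t a q := by simp only [strictMap_append_cons, smul_zero]
  cycle {X Y} p m := by
    simp only [strictMap_append_cons, LinearMap.zero_apply, Path.sumSplit₃, Path.sumSplit_zero,
      add_zero]
    -- Without higher order parts each of the two sums has a single term, and the terms agree
    -- because t commutes with the operations.
    rw [Path.sumSplit_eq_nil_right, Path.sumSplit_eq_nil_left]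
    · exact (congrArg (_ + ·) (ht p m)).trans (add_self_of_two_eq_zero h2 _)
    · intros; rfl
    · intros; exact map_zero _

/-- The projection of a cone to its first summand. -/
def coneFst (f : ModHom M N) (ρ : ℝ) (ε : ℕ → ℝ) (X : A.Ob) :
    (cone f ρ ε).carrier X →ₗ[R] M.carrier X := LinearMap.fst R _ _

/-- The projection of a cone to its second summand. -/
def coneSnd (f : ModHom M N) (ρ : ℝ) (ε : ℕ → ℝ) (X : A.Ob) :
    (cone f ρ ε).carrier X →ₗ[R] N.carrier X := LinearMap.snd R _ _

theorem cone_ext (f : ModHom M N) (ρ : ℝ) (ε : ℕ → ℝ) {X : A.Ob} {x y : (cone f ρ ε).carrier X}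
    (h1 : coneFst f ρ ε X x = coneFst f ρ ε X y) (h2 : coneSnd f ρ ε X x = coneSnd f ρ ε X y) :
    x = y := Prod.ext h1 h2

/-- The homomorphism of mapping cones defined by a square which commutes up to the homotopy `k`. -/
def coneMap (h2 : (2 : R) = 0) {M' N' : FiltModule A} (f : ModHom M N) (g : ModHom M' N')
    (T : ModHom M M') (S : ModHom N N') (k : PreHom M N')
    (hk : ∀ {X Y : A.Ob} (p : Path A.Hom X Y) (m : M.carrier Y), k.diff p m =
      p.sumSplit (fun _ q s => S.map q (f.map s m)) +
        p.sumSplit (fun _ q s => g.map q (T.map s m))) (ρ ρ' : ℝ) (ε ε' : ℕ → ℝ) :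
    ModHom (cone f ρ ε) (cone g ρ' ε') where
  map p := ((T.map p).comp (coneFst f ρ ε _)).prod
    ((k.map p).comp (coneFst f ρ ε _) + (S.map p).comp (coneSnd f ρ ε _))
  map_add p a b q := by
    refine LinearMap.ext fun x => Prod.ext ?_ ?_
    · exact congrArg (fun g => g x.1) (T.map_add p a b q)
    · refine Eq.trans (congrArg₂ (· + ·) (congrArg (fun g => g x.1) (k.map_add p a b q))
        (congrArg (fun g => g x.2) (S.map_add p a b q))) (add_add_add_comm _ _ _ _)
  map_smul p t a q := by
    refine LinearMap.ext fun x => Prod.ext ?_ ?_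
    · exact congrArg (fun g => g x.1) (T.map_smul p t a q)
    · refine Eq.trans (congrArg₂ (· + ·) (congrArg (fun g => g x.1) (k.map_smul p t a q))
        (congrArg (fun g => g x.2) (S.map_smul p t a q))) (smul_add _ _ _).symm
  cycle {X Y} p m := by
    have hT := T.cycle p (coneFst f ρ ε Y m)
    have hS := S.cycle p (coneSnd f ρ ε Y m)
    have hkx := hk p (coneFst f ρ ε Y m)
    refine cone_ext g ρ' ε' ?_ ?_
    · rw [_root_.map_add, _root_.map_add, map_zero, Path.sumSplit₃, Path.map_sumSplit,
        Path.map_sumSplit, Path.map_sumSplit]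
      simp only [Path.map_sumSplit]
      exact hT
    -- In the second component of the cycle equation the unprimed terms come from k, the primed ones
    -- from S, and u, v are the two ways around the square, which cancel against the differential of
    -- k.
    · have aux : ∀ x y z u v x' y' z' : N'.carrier X, x + y + z = u + v → x' + y' + z' = 0 →
          (v + (x + x')) + (y + (u + y')) + (z + z') = 0 := fun x y z u v x' y' z' h h' => by
        have h0 := add_self_of_two_eq_zero h2 (u + v)
        calc (v + (x + x')) + (y + (u + y')) + (z + z')
            = (x + y + z) + (u + v) + (x' + y' + z') := by abel
          _ = 0 := by rw [h, h', h0, add_zero]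
      have h3 := aux _ _ _ _ _ _ _ _ hkx hS
      rw [_root_.map_add, _root_.map_add, map_zero, Path.sumSplit₃, Path.map_sumSplit,
        Path.map_sumSplit, Path.map_sumSplit]
      simp only [Path.map_sumSplit]
      refine Eq.trans (congrArg₂ (· + ·) (congrArg₂ (· + ·) ?_ ?_) ?_) h3
      · change p.sumSplit (fun Z q s => g.map q (T.map s (coneFst f ρ ε Y m)) +
          N'.act q (k.map s (coneFst f ρ ε Y m) + S.map s (coneSnd f ρ ε Y m))) = _
        simp only [_root_.map_add, Path.sumSplit_add]
      · change p.sumSplit (fun Z q s => k.map q (M.act s (coneFst f ρ ε Y m)) +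
          S.map q (f.map s (coneFst f ρ ε Y m) + N.act s (coneSnd f ρ ε Y m))) = _
        simp only [_root_.map_add, Path.sumSplit_add]
      · change p.sumSplit (fun Z q s => s.sumSplit fun W r s' =>
          k.map (q.append (.cons (A.mu r) s')) (coneFst f ρ ε Y m) +
          S.map (q.append (.cons (A.mu r) s')) (coneSnd f ρ ε Y m)) = _
        simp only [Path.sumSplit₃, Path.sumSplit_add]

end ModHom

/-! ### Membership in filtrations -/

theorem FiltModule.mem_of_le (M : FiltModule A) {X : A.Ob} {m : M.carrier X} {α β : ℝ}
    (hm : m ∈ M.filt X α) (h : α ≤ β) : m ∈ M.filt X β := M.filt_mono X h hm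

theorem FiltCat.mem_of_le (A : FiltCat.{u, v, w} R) {X Y : A.Ob} {b : A.Hom X Y} {α β : ℝ}
    (hb : b ∈ A.filt X Y α) (h : α ≤ β) : b ∈ A.filt X Y β := A.filt_mono X Y h hb

theorem mem_cone_filt {M N : FiltModule A} (f : ModHom M N) (ρ : ℝ) (ε : ℕ → ℝ) {X : A.Ob}
    {x : (cone f ρ ε).carrier X} {α : ℝ} : x ∈ (cone f ρ ε).filt X α ↔
      f.coneFst ρ ε X x ∈ M.filt X (α - ρ - ε 1) ∧ f.coneSnd ρ ε X x ∈ N.filt X α := Iff.rfl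

theorem yonedaAct_mem {ε : ℕ → ℝ} (hA : A.HasDiscrepancy ε) {X Y Z : A.Ob} {p : Path A.Hom X Z}
    {b : A.Hom Z Y} {α β : ℝ} (hp : p.Level A.filt α) (hb : b ∈ A.filt Z Y β) :
    A.mu (p.append (.single b)) ∈ A.filt X Y (α + β + ε (p.length + 1)) := by
  rw [← Path.length_append_single p b]
  refine hA.2.2 _ _ ?_ (hp.append_single hb)
  rw [Path.length_append_single]
  omega

/-! ### One step of the reduction -/

section Step

variable {M N : FiltModule A} {Y : A.Ob}

/-- The module endomorphism of a Yoneda module that is the right multiplication by `e` corrected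
by the differential of `h`; its first order part is the identity if `h` is a homotopy between the
right multiplication by `e` and the identity. -/
def unitEnd (h2 : (2 : R) = 0) (e : A.Hom Y Y) (he : A.mu (.single e) = 0)
    (h : ∀ X, A.Hom X Y →ₗ[R] A.Hom X Y) : ModHom (yoneda A Y) (yoneda A Y) :=
  ((yoneda A Y).lambda (L := Y) e he).add (ModHom.commutator h2 (M := yoneda A Y) h)

theorem unitEnd_apply (h2 : (2 : R) = 0) (e : A.Hom Y Y) (he : A.mu (.single e) = 0)
    (h : ∀ X, A.Hom X Y →ₗ[R] A.Hom X Y) {X Z : A.Ob} (p : Path A.Hom X Z) (b : A.Hom Z Y) :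
    (unitEnd h2 e he h).map p b = A.mu ((p.append (.single b)).append (.single e)) +
      (A.mu (p.append (.single (h Z b))) + h X (A.mu (p.append (.single b)))) := rfl

/-- The homotopy equation for h cancels against the first order part of μ₁^mod(h), since 2 = 0. -/
theorem unitEnd_first (h2 : (2 : R) = 0) (e : A.Hom Y Y) (he : A.mu (.single e) = 0)
    (h : ∀ X, A.Hom X Y →ₗ[R] A.Hom X Y)
    (hh : ∀ X (b : A.Hom X Y),
      A.mu (.cons b (.single e)) = b + h X (A.mu (.single b)) + A.mu (.single (h X b)))
    (X : A.Ob) (b : A.Hom X Y) : (unitEnd h2 e he h).map (.nil X) b = b := by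
  refine (unitEnd_apply h2 e he h (.nil X) b).trans ?_
  simp only [Path.append]
  change A.mu (.cons b (.single e)) + _ = b
  have aux : ∀ x y : A.Hom X Y, b + x + y + (y + x) = b := fun x y => by
    calc b + x + y + (y + x) = b + (x + x) + (y + y) := by abel
      _ = b := by rw [add_self_of_two_eq_zero h2, add_self_of_two_eq_zero h2, add_zero, add_zero]
  rw [hh, aux]

/-- The homotopy between `φ ∘ unitEnd` and `τ ∘ λ(c)` for `τ₁(c) = φ₁(e)`. -/
def unitHtpy (τ : ModHom M N) (φ : ModHom (yoneda A Y) N) (c : M.carrier Y) (e : A.Hom Y Y)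
    (h : ∀ X, A.Hom X Y →ₗ[R] A.Hom X Y) : PreHom (yoneda A Y) N :=
  (τ.toPre.insert c).add ((φ.toPre.insert (L := Y) e).add
    (φ.toPre.precomp (P := yoneda A Y) h))

/-- Inserting c into τ leads from τ ∘ λ(c) to λ(τ₁(c)), and inserting e into φ leads from λ(φ₁(e))
to φ ∘ λ(e). The two middle terms coincide by the choice of c, and φ ∘ h accounts for φ ∘ μ₁^mod(h).
-/
theorem unitHtpy_diff (h2 : (2 : R) = 0) (τ : ModHom M N) (φ : ModHom (yoneda A Y) N)
    (c : M.carrier Y) (hc : M.d Y c = 0) (e : A.Hom Y Y) (he : A.mu (.single e) = 0)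
    (h : ∀ X, A.Hom X Y →ₗ[R] A.Hom X Y) (hce : τ.first Y c = φ.first Y e) {X Z : A.Ob}
    (p : Path A.Hom X Z) (b : (yoneda A Y).carrier Z) :
    (unitHtpy τ φ c e h).diff p b =
      p.sumSplit (fun _ q s => τ.map q ((M.lambda c hc).map s b)) +
        p.sumSplit (fun _ q s => φ.map q ((unitEnd h2 e he h).map s b)) := by
  rw [unitHtpy, PreHom.diff_add, PreHom.diff_add]
  have e1 := τ.diff_insert h2 c hc p b
  have e2 := φ.diff_insert h2 (L := Y) e he p b
  have e3 := φ.diff_precomp h2 (M := yoneda A Y) h p b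
  let h' : ∀ X, (yoneda A Y).carrier X →ₗ[R] (yoneda A Y).carrier X := h
  have e4 : p.sumSplit (fun _ q s => φ.map q ((unitEnd h2 e he h).map s b)) =
      p.sumSplit (fun _ q s => φ.map q ((yoneda A Y).act (s.append (.single (C := A.Hom) b)) e)) +
      p.sumSplit (fun W q s =>
        φ.map q ((yoneda A Y).act s (h' Z b) + h' W ((yoneda A Y).act s b))) := by
    rw [← Path.sumSplit_add]
    congr 1
    funext W q s
    exact map_add (φ.map q) _ _
  have aux : ∀ x y z t : N.carrier X, x + z + (y + z + t) = x + (y + t) := fun x y z t => by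
    calc x + z + (y + z + t) = x + (y + t) + (z + z) := by abel
      _ = _ := by rw [add_self_of_two_eq_zero h2, add_zero]
  rw [hce] at e1
  refine (congrArg₂ (· + ·) e1 (congrArg₂ (· + ·) e2 e3)).trans ?_
  rw [e4]
  exact aux _ _ _ _

/-- The homomorphism `Cone(λ(c)) → Cone(φ)` for `τ₁(c) = φ₁(e)`. -/
def unitConeMap (h2 : (2 : R) = 0) (τ : ModHom M N) (φ : ModHom (yoneda A Y) N)
    (c : M.carrier Y) (hc : M.d Y c = 0) (e : A.Hom Y Y) (he : A.mu (.single e) = 0)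
    (h : ∀ X, A.Hom X Y →ₗ[R] A.Hom X Y) (hce : τ.first Y c = φ.first Y e) (s ρ : ℝ)
    (δ : ℕ → ℝ) : ModHom (cone (M.lambda c hc) s 0) (cone φ ρ δ) :=
  ModHom.coneMap h2 _ φ (unitEnd h2 e he h) τ (unitHtpy τ φ c e h)
    (unitHtpy_diff h2 τ φ c hc e he h hce) s ρ 0 δ

/-- Each numerical hypothesis pays for one term of the map of cones. `h1` is for τ on M, and `h2'`,
`h3`, `h4` are for the three parts τ(…, b, c), φ(…, b, e), φ(…, h(b)) of the homotopy. `h5`, `h6`,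
`h7` are for the component in the piece of Y, which carries the shift s in the source and ρ + δ₁ in
the target. -/
theorem unitConeMap_mem (h2 : (2 : R) = 0) (τ : ModHom M N) (φ : ModHom (yoneda A Y) N)
    (c : M.carrier Y) (hc : M.d Y c = 0) (e : A.Hom Y Y) (he : A.mu (.single e) = 0)
    (h : ∀ X, A.Hom X Y →ₗ[R] A.Hom X Y) (hce : τ.first Y c = φ.first Y e)
    {ε δ T T' : ℕ → ℝ} {s ρ γ u κ : ℝ}
    (hh : ∀ X (b : A.Hom X Y),
      A.mu (.cons b (.single e)) = b + h X (A.mu (.single b)) + A.mu (.single (h X b)))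
    (hhκ : ∀ X (α : ℝ), ∀ b ∈ A.filt X Y α, h X b ∈ A.filt X Y (α + κ))
    (hA : A.HasDiscrepancy ε) (hφ : φ.Shifts ρ δ)
    (hτ : ∀ {X Z : A.Ob} (p : Path A.Hom X Z) (m : M.carrier Z) (α β : ℝ), p.Level A.filt α →
      m ∈ M.filt Z β → τ.map p m ∈ N.filt X (α + β + T (p.length + 1)))
    (hcγ : c ∈ M.filt Y γ) (heu : e ∈ A.filt Y Y u)
    (h1 : ∀ d, 1 ≤ d → T d ≤ T' d) (h2' : ∀ d, 1 ≤ d → γ + T (d + 1) ≤ s + T' d)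
    (h3 : ∀ d, 1 ≤ d → u + ρ + δ (d + 1) ≤ s + T' d)
    (h4 : ∀ d, 1 ≤ d → κ + ρ + δ d ≤ s + T' d) (h5 : ρ + δ 1 ≤ s + T' 1)
    (h6 : ∀ d, 2 ≤ d → ρ + δ 1 + u + ε (d + 1) ≤ s + T' d)
    (h7 : ∀ d, 2 ≤ d → ρ + δ 1 + κ + ε d ≤ s + T' d)
    {X Z : A.Ob} (p : Path A.Hom X Z) (x : (cone (M.lambda c hc) s 0).carrier Z) (α β : ℝ)
    (hp : p.Level A.filt α) (hx : x ∈ (cone (M.lambda c hc) s 0).filt Z β) :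
    (unitConeMap h2 τ φ c hc e he h hce s ρ δ).map p x ∈
      (cone φ ρ δ).filt X (α + β + T' (p.length + 1)) := by
  obtain ⟨b, m⟩ := x
  obtain ⟨hb, hm⟩ : b ∈ A.filt Z Y (β - s - 0) ∧ m ∈ M.filt Z β := hx
  rw [sub_zero] at hb
  have hd : 1 ≤ p.length + 1 := by omega
  have hpb := hp.append_single hb
  have hlen := Path.length_append_single p b
  refine (mem_cone_filt φ ρ δ).2 ⟨?_, ?_⟩
  · change (unitEnd h2 e he h).map p b ∈ A.filt X Y _
    -- In order one `unitEnd` is the identity, so only the two shifts of the piece are compared; e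
    -- and h cost something only from order two on.
    cases p with
    | nil =>
      cases hp
      refine (congrArg (· ∈ A.filt X Y _) (unitEnd_first h2 e he h hh X b)).mpr ?_
      refine A.mem_of_le hb ?_
      simp only [Path.length, zero_add]
      linarith
    | cons a p =>
      change A.mu ((Path.append _ (.single (C := A.Hom) b)).append (.single e)) +
        (A.mu (Path.append _ (.single (h Z b))) +
          h X (A.mu (Path.append _ (.single (C := A.Hom) b)))) ∈ A.filt X Y _
      have hd2 : 2 ≤ (Path.cons a p).length + 1 := by simp only [Path.length]; omega
      have i6 := h6 _ hd2
      have i7 := h7 _ hd2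
      refine add_mem ?_ (add_mem ?_ ?_)
      · refine A.mem_of_le (hA.2.2 _ _ ?_ (hpb.append_single heu)) ?_
        · rw [Path.length_append_single]; omega
        · rw [Path.length_append_single, hlen]; linarith
      · refine A.mem_of_le (hA.2.2 _ _ ?_ (hp.append_single (hhκ _ _ _ hb))) ?_
        · rw [Path.length_append_single]; omega
        · rw [Path.length_append_single]; linarith
      · refine A.mem_of_le (hhκ _ _ _ (hA.2.2 _ _ ?_ hpb)) ?_
        · omega
        · rw [hlen]; linarith
  · change (unitHtpy τ φ c e h).map p b + τ.map p m ∈ N.filt X _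
    have i1 := h1 _ hd
    have i2 := h2' _ hd
    have i3 := h3 _ hd
    have i4 := h4 _ hd
    refine add_mem ?_ (N.mem_of_le (hτ p m α β hp hm) (by linarith))
    change τ.map (p.append (.single (C := A.Hom) b)) c +
      (φ.map (p.append (.single (C := A.Hom) b)) e + φ.map p (h Z b)) ∈ N.filt X _
    refine add_mem ?_ (add_mem ?_ ?_)
    · refine N.mem_of_le (hτ _ _ _ _ hpb hcγ) ?_
      rw [hlen]; linarith
    · refine N.mem_of_le (hφ.2 _ _ _ _ hpb heu) ?_
      rw [hlen]; linarith
    · exact N.mem_of_le (hφ.2 _ _ _ _ hp (hhκ _ _ _ hb)) (by linarith)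

/-- The index d + 1 in `h2` comes from c, which is one more argument of the operation of M; the
shift s has to absorb its level γ. -/
theorem cone_lambda_act_mem (c : M.carrier Y) (hc : M.d Y c = 0) {ε T T' : ℕ → ℝ} {s γ : ℝ}
    (hA : A.HasDiscrepancy ε)
    (hM : ∀ {X Z : A.Ob} (p : Path A.Hom X Z) (m : M.carrier Z) (α β : ℝ), p.Level A.filt α →
      m ∈ M.filt Z β → M.act p m ∈ M.filt X (α + β + T (p.length + 1)))
    (hcγ : c ∈ M.filt Y γ) (h1 : ∀ d, 1 ≤ d → T d ≤ T' d)
    (h2 : ∀ d, 1 ≤ d → γ + T (d + 1) ≤ s + T' d) (h3 : ∀ d, 1 ≤ d → ε d ≤ T' d)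
    {X Z : A.Ob} (p : Path A.Hom X Z) (x : (cone (M.lambda c hc) s 0).carrier Z) (α β : ℝ)
    (hp : p.Level A.filt α) (hx : x ∈ (cone (M.lambda c hc) s 0).filt Z β) :
    (cone (M.lambda c hc) s 0).act p x ∈
      (cone (M.lambda c hc) s 0).filt X (α + β + T' (p.length + 1)) := by
  obtain ⟨b, m⟩ := x
  obtain ⟨hb, hm⟩ : b ∈ A.filt Z Y (β - s - 0) ∧ m ∈ M.filt Z β := hx
  rw [sub_zero] at hb
  have hd : 1 ≤ p.length + 1 := by omega
  have hpb := hp.append_single hb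
  have hlen := Path.length_append_single p b
  have i1 := h1 _ hd
  have i2 := h2 _ hd
  have i3 := h3 _ hd
  refine (mem_cone_filt _ s 0).2 ⟨?_, ?_⟩
  · change A.mu (p.append (.single b)) ∈ A.filt X Y (_ - s - 0)
    refine A.mem_of_le (hA.2.2 _ _ (by omega) hpb) ?_
    rw [hlen]; linarith
  · change M.act (p.append (.single b)) c + M.act p m ∈ M.filt X _
    refine add_mem (M.mem_of_le (hM _ _ _ _ hpb hcγ) ?_)
      (M.mem_of_le (hM _ _ _ _ hp hm) (by linarith))
    rw [hlen]; linarith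

/-- The shift of the cone filtration already contains δ₁, so φ_d costs only its excess over δ₁. This
allows discrepancy 0 in order one. -/
theorem cone_act_mem (φ : ModHom (yoneda A Y) N) {ε δ T T' : ℕ → ℝ} {ρ : ℝ}
    (hA : A.HasDiscrepancy ε) (hφ : φ.Shifts ρ δ)
    (hN : ∀ {X Z : A.Ob} (p : Path A.Hom X Z) (m : N.carrier Z) (α β : ℝ), p.Level A.filt α →
      m ∈ N.filt Z β → N.act p m ∈ N.filt X (α + β + T (p.length + 1)))
    (h1 : ∀ d, 1 ≤ d → T d ≤ T' d) (h2 : ∀ d, 1 ≤ d → δ d ≤ δ 1 + T' d)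
    (h3 : ∀ d, 1 ≤ d → ε d ≤ T' d)
    {X Z : A.Ob} (p : Path A.Hom X Z) (x : (cone φ ρ δ).carrier Z) (α β : ℝ)
    (hp : p.Level A.filt α) (hx : x ∈ (cone φ ρ δ).filt Z β) :
    (cone φ ρ δ).act p x ∈ (cone φ ρ δ).filt X (α + β + T' (p.length + 1)) := by
  obtain ⟨b, m⟩ := x
  obtain ⟨hb, hm⟩ : b ∈ A.filt Z Y (β - ρ - δ 1) ∧ m ∈ N.filt Z β := hx
  have hd : 1 ≤ p.length + 1 := by omega
  have hpb := hp.append_single hb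
  have hlen := Path.length_append_single p b
  have i1 := h1 _ hd
  have i2 := h2 _ hd
  have i3 := h3 _ hd
  refine (mem_cone_filt _ ρ δ).2 ⟨?_, ?_⟩
  · change A.mu (p.append (.single b)) ∈ A.filt X Y (_ - ρ - δ 1)
    refine A.mem_of_le (hA.2.2 _ _ (by omega) hpb) ?_
    rw [hlen]; linarith
  · change φ.map p b + N.act p m ∈ N.filt X _
    exact add_mem (N.mem_of_le (hφ.2 _ _ _ _ hp hb) (by linarith))
      (N.mem_of_le (hN _ _ _ _ hp hm) (by linarith))

end Step

/-! ### Pieces of a cone -/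

namespace SplitModule

variable {L : ℕ → A.Ob} {n : ℕ}

section

variable (K : SplitModule A L n) (φ : ModHom (yoneda A (L (n + 1))) K.mod) (ρ : ℝ) (δ : ℕ → ℝ)

theorem step_proj_last (X : A.Ob) (x : (K.step φ ρ δ).mod.carrier X) :
    (K.step φ ρ δ).proj X (Fin.last (n + 1)) x = φ.coneFst ρ δ X x := by
  obtain ⟨b, m⟩ := x
  exact Fin.snoc_last (α := fun i : Fin (n + 2) => A.Hom X (L i)) b (K.split X m)

theorem step_proj_castSucc (X : A.Ob) (i : Fin (n + 1)) (x : (K.step φ ρ δ).mod.carrier X) :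
    (K.step φ ρ δ).proj X i.castSucc x = K.proj X i (φ.coneSnd ρ δ X x) := by
  obtain ⟨b, m⟩ := x
  exact Fin.snoc_castSucc (α := fun i : Fin (n + 2) => A.Hom X (L i)) b (K.split X m) i

theorem step_incl_last_fst (X : A.Ob) (b : A.Hom X (L (n + 1))) :
    φ.coneFst ρ δ X ((K.step φ ρ δ).incl X (Fin.last (n + 1)) b) = b :=
  Pi.single_eq_same (M := fun i : Fin (n + 2) => A.Hom X (L i)) (Fin.last (n + 1)) b

theorem step_incl_last_snd (X : A.Ob) (b : A.Hom X (L (n + 1))) :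
    φ.coneSnd ρ δ X ((K.step φ ρ δ).incl X (Fin.last (n + 1)) b) = 0 := by
  change (K.split X).symm (fun i => Pi.single (M := fun i : Fin (n + 2) => A.Hom X (L i))
    (Fin.last (n + 1)) b i.castSucc) = 0
  rw [LinearEquiv.map_eq_zero_iff]
  funext i
  exact Pi.single_eq_of_ne (M := fun i : Fin (n + 2) => A.Hom X (L i)) (Fin.castSucc_ne_last i) b

theorem step_incl_castSucc_fst (X : A.Ob) (j : Fin (n + 1)) (b : A.Hom X (L j)) :
    φ.coneFst ρ δ X ((K.step φ ρ δ).incl X j.castSucc b) = 0 :=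
  Pi.single_eq_of_ne (M := fun i : Fin (n + 2) => A.Hom X (L i)) (Fin.castSucc_ne_last j).symm b

theorem step_incl_castSucc_snd (X : A.Ob) (j : Fin (n + 1)) (b : A.Hom X (L j)) :
    φ.coneSnd ρ δ X ((K.step φ ρ δ).incl X j.castSucc b) = K.incl X j b := by
  change (K.split X).symm (fun i => Pi.single (M := fun i : Fin (n + 2) => A.Hom X (L i))
    j.castSucc b i.castSucc) = (K.split X).symm (Pi.single j b)
  congr 1
  funext i
  by_cases h : i = j
  · subst h
    exact (Pi.single_eq_same (M := fun i : Fin (n + 2) => A.Hom X (L i)) i.castSucc b).trans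
      (Pi.single_eq_same (M := fun i : Fin (n + 1) => A.Hom X (L i)) i b).symm
  · rw [Pi.single_eq_of_ne h]
    exact Pi.single_eq_of_ne (M := fun i : Fin (n + 2) => A.Hom X (L i))
      (fun h' => h (Fin.castSucc_injective _ h')) b

theorem step_incl_castSucc_mem_iff {X : A.Ob} {j : Fin (n + 1)} {b : A.Hom X (L j)} {α : ℝ} :
    (K.step φ ρ δ).incl X j.castSucc b ∈ (K.step φ ρ δ).mod.filt X α ↔
      K.incl X j b ∈ K.mod.filt X α := by
  refine (mem_cone_filt φ ρ δ).trans ?_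
  rw [step_incl_castSucc_fst, step_incl_castSucc_snd]
  exact and_iff_right (zero_mem _)

theorem step_incl_last_mem_iff {X : A.Ob} {b : A.Hom X (L (n + 1))} {α : ℝ} :
    (K.step φ ρ δ).incl X (Fin.last (n + 1)) b ∈ (K.step φ ρ δ).mod.filt X α ↔
      b ∈ A.filt X (L (n + 1)) (α - ρ - δ 1) := by
  refine (mem_cone_filt φ ρ δ).trans ?_
  rw [step_incl_last_fst, step_incl_last_snd]
  exact and_iff_left (zero_mem _)

end

theorem proj_incl_self (M : SplitModule A L n) (X : A.Ob) (i : Fin (n + 1)) (b : A.Hom X (L i)) :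
    M.proj X i (M.incl X i b) = b := by
  simp [proj, incl]

theorem proj_incl_of_ne (M : SplitModule A L n) (X : A.Ob) {i j : Fin (n + 1)} (h : i ≠ j)
    (b : A.Hom X (L j)) : M.proj X i (M.incl X j b) = 0 := by
  simp [proj, incl, h]

theorem sum_incl_proj (M : SplitModule A L n) (X : A.Ob) (m : M.mod.carrier X) :
    ∑ k, M.incl X k (M.proj X k m) = m := by
  apply (M.split X).injective
  simp only [incl, proj, map_sum, LinearMap.comp_apply, LinearEquiv.coe_coe,
    LinearEquiv.apply_symm_apply, LinearMap.coe_single, LinearMap.proj_apply]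
  exact Finset.univ_sum_single _

theorem ext_proj (M : SplitModule A L n) {X : A.Ob} {m m' : M.mod.carrier X}
    (h : ∀ i, M.proj X i m = M.proj X i m') : m = m' :=
  (M.split X).injective (funext h)

end SplitModule

/-! ### The operations of an iterated cone over the homomorphisms `λ(c)` -/

/-- `∑ μ(a₁, …, a_{d-1}, b, c_{k_d,k_{d-1}}, …, c_{k₂,k₁})` over all chains from `i` to `j`, for
`p = (a₁, …, a_{d-1})`. -/
noncomputable def chainTotal {L : ℕ → A.Ob} (c : ∀ q p : ℕ, A.Hom (L q) (L p)) (i j : ℕ)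
    {X Y : A.Ob} (p : Path A.Hom X Y) (b : A.Hom Y (L j)) : A.Hom X (L i) :=
  ∑ s ∈ (Finset.Ioo i j).powerset,
    A.mu (p.append (.cons b (chainPath c j (s.sort (· ≥ ·)) i)))

theorem chainPath_congr {Ob : Type w} {C : Ob → Ob → Type v} {L : ℕ → Ob}
    {c c' : ∀ q p : ℕ, C (L q) (L p)} (i : ℕ) (l : List ℕ) :
    ∀ j, c j = c' j → (∀ q ∈ l, c q = c' q) → chainPath c j l i = chainPath c' j l i := by
  induction l with
  | nil => intro j hj _; simp only [chainPath, hj]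
  | cons k l ih =>
    intro j hj hl
    simp only [chainPath, hj]
    rw [ih k (hl k List.mem_cons_self) fun q hq => hl q (List.mem_cons_of_mem k hq)]

/-- Chains starting at j involve only rows c_q with q ≤ j, so adding a new row later leaves the
operations obtained so far unchanged. -/
theorem chainTotal_congr {L : ℕ → A.Ob} {c c' : ∀ q p : ℕ, A.Hom (L q) (L p)} {i j : ℕ}
    (h : ∀ q ≤ j, c q = c' q) {X Y : A.Ob} (p : Path A.Hom X Y) (b : A.Hom Y (L j)) :
    chainTotal c i j p b = chainTotal c' i j p b := by
  refine Finset.sum_congr rfl fun s hs => ?_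
  rw [chainPath_congr i _ j (h j le_rfl)]
  intro q hq
  have := Finset.mem_Ioo.1 (Finset.mem_powerset.1 hs ((Finset.mem_sort _).1 hq))
  exact h q this.2.le

/-- Sums over the subsets of an open interval, sorted by the largest element. -/
theorem sum_powerset_Ioo_sort {G : Type*} [AddCommMonoid G] (F : List ℕ → G) {i j : ℕ}
    (hij : i < j) :
    ∑ s ∈ (Finset.Ioo i j).powerset, F (s.sort (· ≥ ·)) =
      F [] + ∑ k ∈ Finset.Ioo i j, ∑ s ∈ (Finset.Ioo i k).powerset, F (k :: s.sort (· ≥ ·)) := by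
  induction j, hij using Nat.le_induction with
  | base =>
    have hI : Finset.Ioo i (i + 1) = ∅ := by
      ext k; simp only [Finset.mem_Ioo, Finset.notMem_empty, iff_false]; omega
    simp [hI]
  | succ j hij ih =>
    have hI : Finset.Ioo i (j + 1) = insert j (Finset.Ioo i j) := by
      ext k; simp only [Finset.mem_Ioo, Finset.mem_insert]; omega
    have hj : j ∉ Finset.Ioo i j := by simp
    -- Subsets of the larger interval either avoid j, and are covered by induction, or contain j,
    -- which then comes first in decreasing order.
    rw [hI, Finset.sum_powerset_insert hj, ih, Finset.sum_insert hj, add_assoc,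
      add_comm (∑ k ∈ _, _)]
    congr 2
    refine Finset.sum_congr rfl fun s hs => ?_
    rw [Finset.sort_insert]
    · intro b hb
      exact (Finset.mem_Ioo.1 (Finset.mem_powerset.1 hs hb)).2.le
    · exact fun hb => hj (Finset.mem_powerset.1 hs hb)

/-- Chains are grouped by their first stop k below j. Once c_{j,k} is taken as the new last
argument, b joins the tuple and a chain from k to i remains. -/
theorem chainTotal_eq_sum {L : ℕ → A.Ob} (c : ∀ q p : ℕ, A.Hom (L q) (L p)) {i j : ℕ}
    (hij : i < j) {X Y : A.Ob} (p : Path A.Hom X Y) (b : A.Hom Y (L j)) :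
    chainTotal c i j p b = A.mu ((p.append (.single b)).append (.single (c j i))) +
      ∑ k ∈ Finset.Ioo i j, chainTotal c i k (p.append (.single b)) (c j k) := by
  rw [chainTotal, sum_powerset_Ioo_sort
    (fun l => A.mu (p.append (.cons b (chainPath c j l i)))) hij]
  simp only [chainTotal, Path.append_assoc, Path.single, Path.append, chainPath]

/-! ### Estimates -/

section Estimates

variable {ε : ℕ → ℝ} {δ : ℕ → ℕ → ℝ}

theorem NonnegSeq.sum_nonneg {f : ℕ → ℝ} (hf : NonnegSeq f) (N : ℕ) :
    0 ≤ ∑ i ∈ Finset.Icc 1 N, f i :=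
  Finset.sum_nonneg fun i hi => hf i (Finset.mem_Icc.1 hi).1

theorem NonnegSeq.sum_mono {f : ℕ → ℝ} (hf : NonnegSeq f) {N N' : ℕ} (h : N ≤ N') :
    ∑ i ∈ Finset.Icc 1 N, f i ≤ ∑ i ∈ Finset.Icc 1 N', f i :=
  Finset.sum_le_sum_of_subset_of_nonneg (Finset.Icc_subset_Icc_right h)
    fun i hi _ => hf i (Finset.mem_Icc.1 hi).1

theorem NonnegSeq.le_sum {f : ℕ → ℝ} (hf : NonnegSeq f) {i N : ℕ} (h1 : 1 ≤ i) (h : i ≤ N) :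
    f i ≤ ∑ i ∈ Finset.Icc 1 N, f i :=
  Finset.single_le_sum (fun i hi => hf i (Finset.mem_Icc.1 hi).1) (Finset.mem_Icc.2 ⟨h1, h⟩)

theorem double_sum_mono {m m' N N' : ℕ} (hδ : ∀ j, 1 ≤ j → j ≤ m' → NonnegSeq (δ j))
    (hm : m ≤ m') (h : N ≤ N') :
    ∑ j ∈ Finset.Icc 1 m, ∑ i ∈ Finset.Icc 1 N, δ j i ≤
      ∑ j ∈ Finset.Icc 1 m', ∑ i ∈ Finset.Icc 1 N', δ j i := by
  refine (Finset.sum_le_sum fun j hj => ?_).trans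
    (Finset.sum_le_sum_of_subset_of_nonneg (Finset.Icc_subset_Icc_right hm) fun j hj _ => ?_)
  · obtain ⟨h1, h2⟩ := Finset.mem_Icc.1 hj
    exact (hδ j h1 (h2.trans hm)).sum_mono h
  · obtain ⟨h1, h2⟩ := Finset.mem_Icc.1 hj
    exact (hδ j h1 h2).sum_nonneg N'

theorem double_sum_nonneg {m : ℕ} (hδ : ∀ j, 1 ≤ j → j ≤ m → NonnegSeq (δ j)) (N : ℕ) :
    0 ≤ ∑ j ∈ Finset.Icc 1 m, ∑ i ∈ Finset.Icc 1 N, δ j i :=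
  Finset.sum_nonneg fun j hj =>
    (hδ j (Finset.mem_Icc.1 hj).1 (Finset.mem_Icc.1 hj).2).sum_nonneg N

theorem chi_mono (hε : NonnegSeq ε) {m m' d d' : ℕ}
    (hδ : ∀ j, 1 ≤ j → j ≤ m' → NonnegSeq (δ j)) (hm : m ≤ m') (h : d + m ≤ d' + m') :
    chi ε δ m d ≤ chi ε δ m' d' :=
  add_le_add (double_sum_mono hδ hm h) (hε.sum_mono h)

theorem chi_nonneg (hε : NonnegSeq ε) {m : ℕ} (hδ : ∀ j, 1 ≤ j → j ≤ m → NonnegSeq (δ j))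
    (d : ℕ) : 0 ≤ chi ε δ m d :=
  add_nonneg (double_sum_nonneg hδ _) (hε.sum_nonneg _)

theorem le_chi (hε : NonnegSeq ε) {m d i : ℕ} (hδ : ∀ j, 1 ≤ j → j ≤ m → NonnegSeq (δ j))
    (h1 : 1 ≤ i) (hi : i ≤ d + m) : ε i ≤ chi ε δ m d :=
  (hε.le_sum h1 hi).trans (le_add_of_nonneg_left (double_sum_nonneg hδ _))

theorem delta_le_chi (hε : NonnegSeq ε) {m d i : ℕ}
    (hδ : ∀ j, 1 ≤ j → j ≤ m + 1 → NonnegSeq (δ j))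
    (h1 : 1 ≤ i) (hi : i ≤ d + (m + 1)) : δ (m + 1) i ≤ chi ε δ (m + 1) d := by
  have h := (hδ (m + 1) (by omega) le_rfl).le_sum h1 hi
  have h' : 0 ≤ ∑ j ∈ Finset.Icc 1 m, ∑ i ∈ Finset.Icc 1 (d + (m + 1)), δ j i :=
    double_sum_nonneg (fun j h1 h2 => hδ j h1 (by omega)) _
  have h'' := hε.sum_nonneg (d + (m + 1))
  rw [chi, Finset.sum_Icc_succ_top (by omega)]
  linarith

theorem xi_mono (hε : NonnegSeq ε) {n n' : ℕ} (κ : ℝ)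
    (hδ : ∀ j, 1 ≤ j → j ≤ n' → NonnegSeq (δ j)) (hn : n ≤ n') :
    xi κ ε δ n ≤ xi κ ε δ n' :=
  add_le_add (add_le_add le_rfl (hε.sum_mono (by omega))) (double_sum_mono hδ hn (by omega))

theorem xi_nonneg (hε : NonnegSeq ε) {n : ℕ} {κ : ℝ} (hκ : 0 ≤ κ)
    (hδ : ∀ j, 1 ≤ j → j ≤ n → NonnegSeq (δ j)) : 0 ≤ xi κ ε δ n :=
  add_nonneg (add_nonneg hκ (hε.sum_nonneg _)) (double_sum_nonneg hδ _)

/-- This is the cost of one reduction step: κ bounds the level of the unit or the shift of h, δ_i is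
the discrepancy of φ₁ or φ₂, and χ_{n,2} that of τ₂ when c is inserted. The index ranges in ξ_{n+1}
contain all of these. -/
theorem add_delta_add_chi_le_xi (hε : NonnegSeq ε) {n i : ℕ} (κ : ℝ)
    (hδ : ∀ j, 1 ≤ j → j ≤ n + 1 → NonnegSeq (δ j)) (h1 : 1 ≤ i) (hi : i ≤ 2) :
    κ + δ (n + 1) i + chi ε δ n 2 ≤ xi κ ε δ (n + 1) := by
  have h := (hδ (n + 1) (by omega) le_rfl).le_sum h1 (N := n + 1 + 2) (by omega)
  have h' : ∑ j ∈ Finset.Icc 1 n, ∑ i ∈ Finset.Icc 1 (2 + n), δ j i ≤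
      ∑ j ∈ Finset.Icc 1 n, ∑ i ∈ Finset.Icc 1 (n + 1 + 2), δ j i :=
    double_sum_mono (fun j h1 h2 => hδ j h1 (by omega)) le_rfl (by omega)
  have h'' := hε.sum_mono (N := 2 + n) (N' := n + 1 + 3) (by omega)
  rw [chi, xi, Finset.sum_Icc_succ_top (b := n) (by omega)]
  linarith

/-- The discrepancy `χ_{n,d}`, improved to `0` for `d = 1`. -/
noncomputable def disc (ε : ℕ → ℝ) (δ : ℕ → ℕ → ℝ) (n d : ℕ) : ℝ :=
  if d = 1 then 0 else chi ε δ n d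

theorem disc_one (ε : ℕ → ℝ) (δ : ℕ → ℕ → ℝ) (n : ℕ) : disc ε δ n 1 = 0 := if_pos rfl

theorem disc_of_two_le (ε : ℕ → ℝ) (δ : ℕ → ℕ → ℝ) (n : ℕ) {d : ℕ} (hd : 2 ≤ d) :
    disc ε δ n d = chi ε δ n d := if_neg (by omega)

theorem disc_nonneg (hε : NonnegSeq ε) {m : ℕ} (hδ : ∀ j, 1 ≤ j → j ≤ m → NonnegSeq (δ j))
    (d : ℕ) : 0 ≤ disc ε δ m d := by
  rw [disc]; split_ifs
  exacts [le_rfl, chi_nonneg hε hδ d]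

theorem disc_le_succ (hε : NonnegSeq ε) {n : ℕ}
    (hδ : ∀ j, 1 ≤ j → j ≤ n + 1 → NonnegSeq (δ j)) (d : ℕ) :
    disc ε δ n d ≤ disc ε δ (n + 1) d := by
  rw [disc, disc]; split_ifs
  exacts [le_rfl, chi_mono hε hδ (by omega) (by omega)]

theorem le_disc (hε : NonnegSeq ε) (hε1 : ε 1 = 0) {n d : ℕ}
    (hδ : ∀ j, 1 ≤ j → j ≤ n → NonnegSeq (δ j)) (hd : 1 ≤ d) : ε d ≤ disc ε δ n d := by
  rw [disc]; split_ifs with h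
  · rw [h, hε1]
  · exact le_chi hε hδ hd (by omega)

theorem delta_le_disc (hε : NonnegSeq ε) {n d : ℕ}
    (hδ : ∀ j, 1 ≤ j → j ≤ n + 1 → NonnegSeq (δ j)) (hd : 1 ≤ d) :
    δ (n + 1) d ≤ δ (n + 1) 1 + disc ε δ (n + 1) d := by
  rw [disc]; split_ifs with h
  · rw [h, add_zero]
  · exact (delta_le_chi hε hδ hd (by omega)).trans
      (le_add_of_nonneg_left (hδ (n + 1) (by omega) le_rfl 1 le_rfl))

end Estimates

variable {L : ℕ → A.Ob}

/-! ### Facts on iterated cones -/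

section IteratedCone

variable {ρ : ℕ → ℝ} {δ : ℕ → ℕ → ℝ} {n : ℕ} {K : SplitModule A L n}

theorem IsIteratedCone.nonneg (hK : IsIteratedCone ρ δ n K) :
    ∀ j, 1 ≤ j → j ≤ n → NonnegSeq (δ j) := by
  induction hK with
  | base => intro j h1 h2; omega
  | @step n K hK φ hφ ih =>
    intro j h1 h2
    rcases h2.lt_or_eq with h | rfl
    · exact ih j h1 (by omega)
    · exact hφ.1

theorem IsIteratedCone.act_mem (hK : IsIteratedCone ρ δ n K) {ε : ℕ → ℝ}
    (hA : A.HasDiscrepancy ε) {X Y : A.Ob} (p : Path A.Hom X Y) (m : K.mod.carrier Y) (α β : ℝ)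
    (hp : p.Level A.filt α) (hm : m ∈ K.mod.filt Y β) :
    K.mod.act p m ∈ K.mod.filt X (α + β + disc ε δ n (p.length + 1)) := by
  induction hK generalizing X Y p α β with
  | base =>
    refine A.mem_of_le (yonedaAct_mem hA hp hm) ?_
    have := le_disc (δ := δ) (n := 0) hA.1 hA.2.1 (fun j h1 h2 => by omega)
      (Nat.succ_le_succ (Nat.zero_le p.length))
    linarith
  | @step n K hK φ hφ ih =>
    have hδ := (hK.step φ hφ).nonneg
    exact cone_act_mem φ hA hφ (T' := disc ε δ (n + 1)) (fun p m α β => ih p m α β)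
      (fun d _ => disc_le_succ hA.1 hδ d) (fun d hd => delta_le_disc hA.1 hδ hd)
      (fun d hd => le_disc hA.1 hA.2.1 hδ hd) p m α β hp hm

/-- In every cone C(X, L₀) lies in the second summand, which is never shifted. -/
theorem IsIteratedCone.incl_zero_mem_iff (hK : IsIteratedCone ρ δ n K) {X : A.Ob}
    (b : A.Hom X (L 0)) {α : ℝ} : K.incl X 0 b ∈ K.mod.filt X α ↔ b ∈ A.filt X (L 0) α := by
  induction hK with
  | base => exact Iff.rfl
  | @step n K hK φ hφ ih =>
    exact (K.step_incl_castSucc_mem_iff φ (ρ (n + 1)) (δ (n + 1)) (j := 0)).trans ih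

theorem IsIteratedCone.d_incl_zero (hK : IsIteratedCone ρ δ n K) {X : A.Ob}
    (b : A.Hom X (L 0)) : K.mod.d X (K.incl X 0 b) = K.incl X 0 (A.mu (.single b)) := by
  induction hK with
  | base => rfl
  | @step n K hK φ hφ ih =>
    have h1 := K.step_incl_castSucc_fst φ (ρ (n + 1)) (δ (n + 1)) X 0
    have h2 := K.step_incl_castSucc_snd φ (ρ (n + 1)) (δ (n + 1)) X 0
    refine φ.cone_ext (ρ (n + 1)) (δ (n + 1)) ?_ ?_
    · refine Eq.trans ?_ (h1 _).symm
      exact (congrArg (yonedaAct A (L (n + 1)) (.nil X)) (h1 b)).trans (map_zero _)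
    · refine Eq.trans ?_ (h2 _).symm
      refine Eq.trans ?_ ih
      refine (congrArg₂ (· + ·) (congrArg (φ.map (.nil X)) (h1 b))
        (congrArg (K.mod.act (.nil X)) (h2 b))).trans ?_
      exact (congrArg (· + _) (map_zero _)).trans (zero_add _)

end IteratedCone

/-! ### The reduction of an iterated cone -/

/-- The bound `(2^n - 1) ξ_n` for the action shift. -/
noncomputable def shiftBound (κ : ℝ) (ε : ℕ → ℝ) (δ : ℕ → ℕ → ℝ) (n : ℕ) : ℝ :=
  (2 ^ n - 1) * xi κ ε δ n

/-- A reduction of a split module `K` to an iterated cone `red` over homomorphisms `λ(c)`: a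
module homomorphism `tau : red → K` whose first order part is an isomorphism, together with the
estimates for it. -/
structure Reduction (κ : ℝ) (ε : ℕ → ℝ) (ρ : ℕ → ℝ) (δ : ℕ → ℕ → ℝ) {n : ℕ}
    (K : SplitModule A L n) where
  red : SplitModule A L n
  tau : ModHom red.mod K.mod
  iso : ∀ X, red.mod.carrier X ≃ₗ[R] K.mod.carrier X
  iso_apply : ∀ X m, iso X m = tau.first X m
  c : ∀ q p : ℕ, A.Hom (L q) (L p)
  c_mem : ∀ q p : ℕ, p < q → q ≤ n →
    c q p ∈ A.filt (L q) (L p) (ρ q - ρ p + 2 ^ q * xi κ ε δ q)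
  act_lt : ∀ {X Y : A.Ob} (p : Path A.Hom X Y) (i j : Fin (n + 1)), i < j →
    ∀ b : A.Hom Y (L j), red.proj X i (red.mod.act p (red.incl Y j b)) = chainTotal c i j p b
  act_self : ∀ {X Y : A.Ob} (p : Path A.Hom X Y) (i : Fin (n + 1)) (b : A.Hom Y (L i)),
    red.proj X i (red.mod.act p (red.incl Y i b)) = A.mu (p.append (.single b))
  act_gt : ∀ {X Y : A.Ob} (p : Path A.Hom X Y) (i j : Fin (n + 1)), j < i →
    ∀ b : A.Hom Y (L j), red.proj X i (red.mod.act p (red.incl Y j b)) = 0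
  -- Triangularity is recorded for the inverse because σ₁ is the inverse of τ₁.
  iso_gt : ∀ (X : A.Ob) (i j : Fin (n + 1)), j < i → ∀ b : A.Hom X (L j),
    red.proj X i ((iso X).symm (K.incl X j b)) = 0
  iso_self : ∀ (X : A.Ob) (i : Fin (n + 1)) (b : A.Hom X (L i)),
    red.proj X i ((iso X).symm (K.incl X i b)) = b
  act_mem : ∀ {X Y : A.Ob} (p : Path A.Hom X Y) (m : red.mod.carrier Y) (α β : ℝ),
    p.Level A.filt α → m ∈ red.mod.filt Y β →
      red.mod.act p m ∈ red.mod.filt X (α + β + disc ε δ n (p.length + 1))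
  tau_mem : ∀ {X Y : A.Ob} (p : Path A.Hom X Y) (m : red.mod.carrier Y) (α β : ℝ),
    p.Level A.filt α → m ∈ red.mod.filt Y β →
      tau.map p m ∈ K.mod.filt X (α + β + disc ε δ n (p.length + 1))
  symm_mem : ∀ (X : A.Ob) (α : ℝ), ∀ m ∈ K.mod.filt X α,
    (iso X).symm m ∈ red.mod.filt X (α + shiftBound κ ε δ n)
  -- The piece of L_j is shifted in red by at least ρ_j; this converts the level of `vec` into the
  -- bounds for its components c_{q,p}.
  proj_mem : ∀ (X : A.Ob) (α : ℝ), ∀ m ∈ red.mod.filt X α, ∀ j : Fin (n + 1),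
    red.proj X j m ∈ A.filt X (L j) (α - ρ j)
  incl_mem : ∀ (X : A.Ob) (j : Fin (n + 1)) (α : ℝ) (b : A.Hom X (L j)),
    K.incl X j b ∈ K.mod.filt X α → red.incl X j b ∈ red.mod.filt X (α + shiftBound κ ε δ n)
  incl_zero_mem_iff : ∀ {X : A.Ob} (b : A.Hom X (L 0)) (α : ℝ),
    red.incl X 0 b ∈ red.mod.filt X α ↔ b ∈ A.filt X (L 0) α

namespace Reduction

variable {κ : ℝ} {ε : ℕ → ℝ} {ρ : ℕ → ℝ} {δ : ℕ → ℕ → ℝ}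

/-- The trivial reduction of a Yoneda module. -/
def base (h2 : (2 : R) = 0) (hA : A.HasDiscrepancy ε) (hρ : ρ 0 = 0) :
    Reduction κ ε ρ δ (SplitModule.base A L) where
  red := SplitModule.base A L
  tau := .strict h2 (fun _ => LinearMap.id) fun _ _ => rfl
  iso X := LinearEquiv.refl R _
  iso_apply X m := rfl
  c q p := 0
  c_mem q p h1 h2 := by omega
  act_lt p i j h := absurd h (by omega)
  act_self p i b := by
    obtain rfl : i = 0 := Fin.eq_zero i
    rfl
  act_gt p i j h := absurd h (by omega)
  iso_gt X i j h := absurd h (by omega)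
  iso_self X i b := (SplitModule.base A L).proj_incl_self X i b
  act_mem p m α β := (IsIteratedCone.base (L := L) (ρ := ρ) (δ := δ)).act_mem hA p m α β
  tau_mem {X Y} p m α β hp hm := by
    have hd := disc_nonneg (δ := δ) hA.1 (m := 0) (fun j h1 h2 => by omega) (p.length + 1)
    cases hp with
    | nil => exact (SplitModule.base A L).mod.mem_of_le hm (by linarith)
    | cons _ _ => exact zero_mem _
  symm_mem X α m hm := (SplitModule.base A L).mod.mem_of_le (m := m) hm (by simp [shiftBound])
  proj_mem X α m hm j := by
    obtain rfl : j = 0 := Fin.eq_zero j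
    exact A.mem_of_le hm (by rw [Fin.val_zero, hρ, sub_zero])
  incl_mem X j α b hb := (SplitModule.base A L).mod.mem_of_le hb (by simp [shiftBound])
  incl_zero_mem_iff b α := Iff.rfl

section Step

variable {n : ℕ} {K : SplitModule A L n} (T : Reduction κ ε ρ δ K)
  (φ : ModHom (yoneda A (L (n + 1))) K.mod) (e : A.Hom (L (n + 1)) (L (n + 1)))

/-- The element `c ∈ red(L_{n+1})` with `τ₁(c) = φ₁(e)`. -/
def vec : T.red.mod.carrier (L (n + 1)) :=
  (T.iso (L (n + 1))).symm (φ.first (L (n + 1)) e)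

theorem first_vec : T.tau.first (L (n + 1)) (T.vec φ e) = φ.first (L (n + 1)) e := by
  rw [← T.iso_apply, vec, LinearEquiv.apply_symm_apply]

/-- The image of `vec` under the injective chain map τ₁ is φ₁(e), which is a cycle. -/
theorem d_vec (h2 : (2 : R) = 0) (he : A.mu (.single e) = 0) :
    T.red.mod.d (L (n + 1)) (T.vec φ e) = 0 := by
  apply (T.iso (L (n + 1))).injective
  rw [T.iso_apply, ← T.tau.d_first h2, T.first_vec, map_zero]
  exact (φ.d_first h2 _ _).trans ((congrArg (φ.first (L (n + 1))) he).trans (map_zero _))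

/-- The elements `c_{q,p}`, extended by the components of `vec`. -/
noncomputable def extendC : ∀ q p : ℕ, A.Hom (L q) (L p) :=
  Function.update T.c (n + 1) fun p =>
    if hp : p < n + 1 then T.red.proj (L (n + 1)) ⟨p, hp⟩ (T.vec φ e) else 0

theorem extendC_of_le {q : ℕ} (hq : q ≤ n) : T.extendC φ e q = T.c q :=
  Function.update_of_ne (by omega) _ _

theorem extendC_top (i : Fin (n + 1)) :
    T.extendC φ e (n + 1) i = T.red.proj (L (n + 1)) i (T.vec φ e) := by
  rw [extendC, Function.update_self]
  exact dif_pos i.2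

/-- Split `vec` into its components c_{n+1,k}. Those with k < i do not reach the piece i, the one
with k = i gives the direct term, and those with k > i give the chains whose first stop is k. -/
theorem proj_act_vec {X Y : A.Ob} (p : Path A.Hom X Y) (b : A.Hom Y (L (n + 1)))
    (i : Fin (n + 1)) :
    T.red.proj X i (T.red.mod.act (p.append (.single b)) (T.vec φ e)) =
      chainTotal (T.extendC φ e) i (n + 1) p b := by
  rw [chainTotal_eq_sum _ i.2, ← T.red.sum_incl_proj (L (n + 1)) (T.vec φ e), map_sum, map_sum]
  have hg : ∀ k : Fin (n + 1),
      T.red.proj X i (T.red.mod.act (p.append (.single b))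
        (T.red.incl (L (n + 1)) k (T.red.proj (L (n + 1)) k (T.vec φ e)))) =
      (fun k : ℕ => if k < i then 0 else if k = i then
        A.mu ((p.append (.single b)).append (.single (T.extendC φ e (n + 1) i))) else
        chainTotal (T.extendC φ e) i k (p.append (.single b)) (T.extendC φ e (n + 1) k)) k := by
    intro k
    rw [← T.extendC_top φ e k]
    rcases lt_trichotomy i k with h | rfl | h
    · have h' : (i : ℕ) < k := h
      simp only [if_neg h'.not_gt, if_neg h'.ne']
      rw [T.act_lt _ _ _ h]
      exact chainTotal_congr (fun q hq => (T.extendC_of_le φ e (by omega)).symm) _ _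
    · simp only [lt_irrefl, if_false, if_true]
      rw [T.act_self]
    · have h' : (k : ℕ) < i := h
      simp only [if_pos h']
      rw [T.act_gt _ _ _ h]
  rw [Finset.sum_congr rfl fun k _ => hg k, Fin.sum_univ_eq_sum_range
    (fun k : ℕ => if k < (i : ℕ) then 0 else if k = i then
      A.mu ((p.append (.single b)).append (.single (T.extendC φ e (n + 1) i))) else
      chainTotal (T.extendC φ e) i k (p.append (.single b)) (T.extendC φ e (n + 1) k)) (n + 1)]
  have hsub : insert (i : ℕ) (Finset.Ioo (i : ℕ) (n + 1)) ⊆ Finset.range (n + 1) := by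
    intro k hk
    have := i.2
    simp only [Finset.mem_insert, Finset.mem_Ioo] at hk
    rw [Finset.mem_range]
    omega
  rw [← Finset.sum_subset hsub, Finset.sum_insert (by simp)]
  · congr 1
    · simp
    · refine Finset.sum_congr rfl fun k hk => ?_
      have hk := (Finset.mem_Ioo.1 hk).1
      rw [if_neg hk.not_gt, if_neg hk.ne']
  · intro k hk hk'
    rw [Finset.mem_range] at hk
    simp only [Finset.mem_insert, Finset.mem_Ioo] at hk'
    exact if_pos (by omega)

/-- The iterated cone extended by the homomorphism `λ(c)`. -/
def extend (h2 : (2 : R) = 0) (he : A.mu (.single e) = 0) (s : ℝ) : SplitModule A L (n + 1) :=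
  T.red.step (T.red.mod.lambda (T.vec φ e) (T.d_vec φ e h2 he)) s 0

variable {T φ e} in
theorem extend_act_last {h2 : (2 : R) = 0} {he : A.mu (.single e) = 0} {s : ℝ} {X Y : A.Ob}
    (p : Path A.Hom X Y) (x : (T.extend φ e h2 he s).mod.carrier Y) :
    (T.extend φ e h2 he s).proj X (Fin.last (n + 1)) ((T.extend φ e h2 he s).mod.act p x) =
      A.mu (p.append (.single (C := A.Hom) (ModHom.coneFst _ s 0 Y x))) :=
  T.red.step_proj_last _ s 0 X _

variable {T φ e} in
theorem extend_act_castSucc {h2 : (2 : R) = 0} {he : A.mu (.single e) = 0} {s : ℝ} {X Y : A.Ob}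
    (p : Path A.Hom X Y) (i : Fin (n + 1)) (x : (T.extend φ e h2 he s).mod.carrier Y) :
    (T.extend φ e h2 he s).proj X i.castSucc ((T.extend φ e h2 he s).mod.act p x) =
      T.red.proj X i (T.red.mod.act (p.append (.single (C := A.Hom) (ModHom.coneFst _ s 0 Y x)))
        (T.vec φ e)) + T.red.proj X i (T.red.mod.act p (ModHom.coneSnd _ s 0 Y x)) :=
  (T.red.step_proj_castSucc _ s 0 X i _).trans (map_add _ _ _)

theorem mu_append_single_zero {X Y Z : A.Ob} (p : Path A.Hom X Y) :
    A.mu (p.append (.single (0 : A.Hom Y Z))) = 0 := (yonedaAct A Z p).map_zero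

theorem act_append_single_zero (M : FiltModule A) {X Y Z : A.Ob} (p : Path A.Hom X Y) :
    M.act (p.append (.single (0 : A.Hom Y Z))) = 0 := M.actPre.map_cons_zero p (.nil Z)

theorem extend_act_incl_last {h2 : (2 : R) = 0} {he : A.mu (.single e) = 0} {s : ℝ} {X Y : A.Ob}
    (p : Path A.Hom X Y) (i : Fin (n + 1)) (b : A.Hom Y (L (n + 1))) :
    (T.extend φ e h2 he s).proj X i.castSucc ((T.extend φ e h2 he s).mod.act p
      ((T.extend φ e h2 he s).incl Y (Fin.last (n + 1)) b)) =
      chainTotal (T.extendC φ e) i (n + 1) p b := by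
  rw [extend_act_castSucc]
  have h1 := T.red.step_incl_last_fst (T.red.mod.lambda (T.vec φ e) (T.d_vec φ e h2 he)) s 0 Y b
  have h3 := T.red.step_incl_last_snd (T.red.mod.lambda (T.vec φ e) (T.d_vec φ e h2 he)) s 0 Y b
  refine (congrArg₂ (· + ·) (congrArg (fun b => T.red.proj X i (T.red.mod.act
    (p.append (.single (C := A.Hom) b)) (T.vec φ e))) h1)
    (congrArg (fun m => T.red.proj X i (T.red.mod.act p m)) h3)).trans ?_
  simp only [map_zero, add_zero]
  exact T.proj_act_vec φ e p b i

theorem extend_act_incl_castSucc {h2 : (2 : R) = 0} {he : A.mu (.single e) = 0} {s : ℝ}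
    {X Y : A.Ob} (p : Path A.Hom X Y) (i j : Fin (n + 1)) (b : A.Hom Y (L j)) :
    (T.extend φ e h2 he s).proj X i.castSucc ((T.extend φ e h2 he s).mod.act p
      ((T.extend φ e h2 he s).incl Y j.castSucc b)) =
      T.red.proj X i (T.red.mod.act p (T.red.incl Y j b)) := by
  rw [extend_act_castSucc]
  have h1 := T.red.step_incl_castSucc_fst
    (T.red.mod.lambda (T.vec φ e) (T.d_vec φ e h2 he)) s 0 Y j b
  have h3 := T.red.step_incl_castSucc_snd
    (T.red.mod.lambda (T.vec φ e) (T.d_vec φ e h2 he)) s 0 Y j b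
  refine (congrArg₂ (· + ·) (congrArg (fun b => T.red.proj X i (T.red.mod.act
    (p.append (.single (C := A.Hom) b)) (T.vec φ e))) h1)
    (congrArg (fun m => T.red.proj X i (T.red.mod.act p m)) h3)).trans ?_
  refine (congrArg (· + _) ?_).trans (zero_add _)
  refine (congrArg (fun g => T.red.proj X i (g (T.vec φ e)))
    (act_append_single_zero T.red.mod p)).trans ?_
  exact map_zero _

/-- The homomorphism from the extended iterated cone to the cone of `φ`. -/
def extendTau (h2 : (2 : R) = 0) (he : A.mu (.single e) = 0)
    (h : ∀ X, A.Hom X (L (n + 1)) →ₗ[R] A.Hom X (L (n + 1))) (s ρ' : ℝ) (δ' : ℕ → ℝ) :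
    ModHom (T.extend φ e h2 he s).mod (K.step φ ρ' δ').mod :=
  unitConeMap h2 T.tau φ (T.vec φ e) (T.d_vec φ e h2 he) e he h (T.first_vec φ e) s ρ' δ'

/-- The first order part of `extendTau` as an isomorphism. -/
def extendIso (h2 : (2 : R) = 0) (he : A.mu (.single e) = 0)
    (h : ∀ X, A.Hom X (L (n + 1)) →ₗ[R] A.Hom X (L (n + 1))) (s ρ' : ℝ) (δ' : ℕ → ℝ) (X : A.Ob) :
    (T.extend φ e h2 he s).mod.carrier X ≃ₗ[R] (K.step φ ρ' δ').mod.carrier X :=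
  LinearEquiv.skewProd (LinearEquiv.refl R (A.Hom X (L (n + 1)))) (T.iso X)
    ((unitHtpy T.tau φ (T.vec φ e) e h).map (.nil X))

variable (h2 : (2 : R) = 0) (he : A.mu (.single e) = 0)
  (h : ∀ X, A.Hom X (L (n + 1)) →ₗ[R] A.Hom X (L (n + 1))) (s ρ' : ℝ) (δ' : ℕ → ℝ)

theorem extendIso_apply
    (hh : ∀ X (b : A.Hom X (L (n + 1))),
      A.mu (.cons b (.single e)) = b + h X (A.mu (.single b)) + A.mu (.single (h X b)))
    (X : A.Ob) (x : (T.extend φ e h2 he s).mod.carrier X) :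
    T.extendIso φ e h2 he h s ρ' δ' X x = (T.extendTau φ e h2 he h s ρ' δ').first X x := by
  obtain ⟨b, m⟩ := x
  refine φ.cone_ext ρ' δ' ?_ ?_
  · exact (unitEnd_first h2 e he h hh X b).symm
  · exact (congrArg (· + _) (T.iso_apply X m)).trans (add_comm _ _)

theorem fst_extendIso_symm (X : A.Ob) (x : (K.step φ ρ' δ').mod.carrier X) :
    ModHom.coneFst _ s 0 X ((T.extendIso φ e h2 he h s ρ' δ' X).symm x) = φ.coneFst ρ' δ' X x :=
  rfl

theorem snd_extendIso_symm (X : A.Ob) (x : (K.step φ ρ' δ').mod.carrier X) :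
    ModHom.coneSnd _ s 0 X ((T.extendIso φ e h2 he h s ρ' δ' X).symm x) =
      (T.iso X).symm (φ.coneSnd ρ' δ' X x -
        (unitHtpy T.tau φ (T.vec φ e) e h).map (.nil X) (φ.coneFst ρ' δ' X x)) :=
  rfl

theorem proj_last_extendIso_symm (X : A.Ob) (x : (K.step φ ρ' δ').mod.carrier X) :
    (T.extend φ e h2 he s).proj X (Fin.last (n + 1))
      ((T.extendIso φ e h2 he h s ρ' δ' X).symm x) = φ.coneFst ρ' δ' X x :=
  T.red.step_proj_last _ s 0 X _

theorem proj_castSucc_extendIso_symm (X : A.Ob) (i j : Fin (n + 1)) (b : A.Hom X (L j)) :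
    (T.extend φ e h2 he s).proj X i.castSucc ((T.extendIso φ e h2 he h s ρ' δ' X).symm
      ((K.step φ ρ' δ').incl X j.castSucc b)) =
      T.red.proj X i ((T.iso X).symm (K.incl X j b)) := by
  refine (T.red.step_proj_castSucc _ s 0 X i _).trans ?_
  rw [snd_extendIso_symm, SplitModule.step_incl_castSucc_fst, SplitModule.step_incl_castSucc_snd,
    map_zero, sub_zero]

variable {φ e h} {u : ℝ}

/-- One step of the reduction. -/
noncomputable def step (hA : A.HasDiscrepancy ε)
    (hδ : ∀ j, 1 ≤ j → j ≤ n + 1 → NonnegSeq (δ j))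
    (hφ : φ.Shifts (ρ (n + 1)) (δ (n + 1))) (hu : 0 ≤ u) (huκ : u ≤ κ)
    (heu : e ∈ A.filt (L (n + 1)) (L (n + 1)) u)
    (hhκ : ∀ X (α : ℝ), ∀ b ∈ A.filt X (L (n + 1)) α, h X b ∈ A.filt X (L (n + 1)) (α + κ))
    (hh : ∀ X (b : A.Hom X (L (n + 1))),
      A.mu (.cons b (.single e)) = b + h X (A.mu (.single b)) + A.mu (.single (h X b))) :
    Reduction κ ε ρ δ (K.step φ (ρ (n + 1)) (δ (n + 1))) := by
  have hκ : 0 ≤ κ := hu.trans huκ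
  have hδn : ∀ j, 1 ≤ j → j ≤ n → NonnegSeq (δ j) := fun j h1 h2 => hδ j h1 (by omega)
  set ξ := xi κ ε δ (n + 1) with hξ
  -- Q is the shift of the new piece beyond ρ_{n+1}. It exceeds the shift P of τ₁⁻¹ by at least ξ
  -- (`hPQ`), which is the room needed for e, h, φ and τ₂.
  set Q := (2 : ℝ) ^ n * ξ with hQ
  set P := shiftBound κ ε δ n with hP
  have hpow : (1 : ℝ) ≤ 2 ^ n := one_le_pow₀ (by norm_num)
  have hξ0 : 0 ≤ ξ := xi_nonneg hA.1 hκ hδ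
  have hξn : xi κ ε δ n ≤ ξ := xi_mono hA.1 κ hδ (by omega)
  have hP0 : 0 ≤ P := mul_nonneg (by linarith) (xi_nonneg hA.1 hκ hδn)
  have hPQ : P + ξ ≤ Q := by
    have := mul_le_mul_of_nonneg_left hξn (sub_nonneg.2 hpow)
    rw [hP, hQ, shiftBound]
    linarith
  have hP' : shiftBound κ ε δ (n + 1) = 2 * Q - ξ := by
    rw [shiftBound, hQ, pow_succ]; ring
  have hδ1 : 0 ≤ δ (n + 1) 1 := hφ.1 1 le_rfl
  have hχ0 := chi_nonneg hA.1 hδn 2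
  have hξ1 := add_delta_add_chi_le_xi (i := 1) hA.1 κ hδ le_rfl (by norm_num)
  have hξ2 := add_delta_add_chi_le_xi (i := 2) hA.1 κ hδ (by norm_num) le_rfl
  have hvec : T.vec φ e ∈ T.red.mod.filt (L (n + 1)) (u + ρ (n + 1) + δ (n + 1) 1 + P) := by
    refine T.symm_mem _ _ _ (K.mod.mem_of_le (hφ.2 (.nil _) e 0 u (.nil _) heu) (le_of_eq ?_))
    simp only [Path.length, zero_add]
  -- Inserting `vec` into an operation of red or into τ raises the order from d to d + 1.
  have hd : ∀ d, 1 ≤ d → u + δ (n + 1) 1 + P + disc ε δ n (d + 1) ≤ Q + disc ε δ (n + 1) d := by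
    intro d hd
    rw [disc_of_two_le ε δ n (show 2 ≤ d + 1 by omega)]
    rcases hd.eq_or_lt with rfl | hd
    · rw [disc_one]; linarith
    · rw [disc_of_two_le ε δ (n + 1) hd]
      -- Both χ_{n,d+1} and χ_{n+1,d} sum up to the index n + d + 1, so the extra argument is
      -- absorbed by the additional cone.
      have := chi_mono (m := n) (m' := n + 1) (d := d + 1) (d' := d) hA.1 hδ (by omega) (by omega)
      linarith
  have hmem := fun {X Z : A.Ob} => unitConeMap_mem h2 T.tau φ (T.vec φ e) (T.d_vec φ e h2 he) e he h
    (T.first_vec φ e) (T := disc ε δ n) (T' := disc ε δ (n + 1)) (s := ρ (n + 1) + Q) hh hhκ hA hφ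
    (fun p m α β => T.tau_mem p m α β) hvec heu (fun d _ => disc_le_succ hA.1 hδ d)
    (fun d h1 => by linarith [hd d h1])
    (fun d h1 => by
      rcases h1.eq_or_lt with rfl | h1
      · rw [disc_one]; linarith
      · have := delta_le_chi (d := d) (i := d + 1) hA.1 hδ (by omega) (by omega)
        rw [disc_of_two_le ε δ (n + 1) h1]; linarith)
    (fun d h1 => by linarith [delta_le_disc hA.1 hδ h1])
    (by rw [disc_one]; linarith)
    (fun d h1 => by
      have := le_chi (d := d) (i := d + 1) hA.1 hδ (by omega) (by omega)
      rw [disc_of_two_le ε δ (n + 1) h1]; linarith)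
    (fun d h1 => by linarith [le_disc hA.1 hA.2.1 hδ (show 1 ≤ d by omega)]) (X := X) (Z := Z)
  exact
  { red := T.extend φ e h2 he (ρ (n + 1) + Q)
    tau := T.extendTau φ e h2 he h (ρ (n + 1) + Q) (ρ (n + 1)) (δ (n + 1))
    iso := T.extendIso φ e h2 he h (ρ (n + 1) + Q) (ρ (n + 1)) (δ (n + 1))
    iso_apply := T.extendIso_apply φ e h2 he h _ _ _ hh
    c := T.extendC φ e
    c_mem := fun q p hpq hq => by
      rcases hq.lt_or_eq with hq | rfl
      · rw [T.extendC_of_le φ e (by omega)]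
        exact T.c_mem q p hpq (by omega)
      · have h3 := T.extendC_top φ e ⟨p, hpq⟩
        rw [show T.extendC φ e (n + 1) p = _ from h3]
        -- The level of `vec` is ρ_{n+1} + (u + δ₁ + P), and the bracket is at most ξ + P ≤ Q.
        refine A.mem_of_le (T.proj_mem _ _ _ hvec ⟨p, hpq⟩) ?_
        rw [pow_succ]
        linarith
    act_lt := fun {X Y} p i j => by
      induction j using Fin.lastCases with
      | last =>
        induction i using Fin.lastCases with
        | last => exact fun h => absurd h (lt_irrefl _)
        | cast i => exact fun _ b => T.extend_act_incl_last φ e p i b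
      | cast j =>
        induction i using Fin.lastCases with
        | last => exact fun h => absurd h (Fin.castSucc_lt_last j).not_gt
        | cast i =>
          intro hij b
          refine (T.extend_act_incl_castSucc φ e p i j b).trans ?_
          rw [T.act_lt p i j (Fin.castSucc_lt_castSucc_iff.1 hij)]
          refine chainTotal_congr (fun q hq => (T.extendC_of_le φ e ?_).symm) p b
          have hq : q ≤ (j : ℕ) := hq
          omega
    act_self := fun {X Y} p i => by
      induction i using Fin.lastCases with
      | last =>
        intro b
        rw [extend_act_last]
        exact congrArg (fun b => A.mu (p.append (.single (C := A.Hom) b)))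
          (T.red.step_incl_last_fst _ _ 0 Y b)
      | cast i => exact fun b => (T.extend_act_incl_castSucc φ e p i i b).trans (T.act_self p i b)
    act_gt := fun {X Y} p i j => by
      induction j using Fin.lastCases with
      | last => exact fun h => absurd h (Fin.le_last i).not_gt
      | cast j =>
        induction i using Fin.lastCases with
        | last =>
          intro _ b
          rw [extend_act_last]
          refine (congrArg (fun b => A.mu (p.append (.single (C := A.Hom) b)))
            (T.red.step_incl_castSucc_fst _ _ 0 Y j b)).trans ?_
          exact mu_append_single_zero p
        | cast i =>
          exact fun hij b => (T.extend_act_incl_castSucc φ e p i j b).trans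
            (T.act_gt p i j (Fin.castSucc_lt_castSucc_iff.1 hij) b)
    iso_gt := fun X i j => by
      induction j using Fin.lastCases with
      | last => exact fun h => absurd h (Fin.le_last i).not_gt
      | cast j =>
        induction i using Fin.lastCases with
        | last =>
          intro _ b
          rw [proj_last_extendIso_symm]
          exact K.step_incl_castSucc_fst φ _ _ X j b
        | cast i =>
          exact fun hij b => (T.proj_castSucc_extendIso_symm φ e h2 he h _ _ _ X i j b).trans
            (T.iso_gt X i j (Fin.castSucc_lt_castSucc_iff.1 hij) b)
    iso_self := fun X i => by
      induction i using Fin.lastCases with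
      | last =>
        intro b
        rw [proj_last_extendIso_symm]
        exact K.step_incl_last_fst φ _ _ X b
      | cast i =>
        exact fun b => (T.proj_castSucc_extendIso_symm φ e h2 he h _ _ _ X i i b).trans
          (T.iso_self X i b)
    act_mem := fun p m α β => cone_lambda_act_mem (T := disc ε δ n) _ _ hA
      (fun p m α β => T.act_mem p m α β) hvec (fun d _ => disc_le_succ hA.1 hδ d)
      (fun d h1 => by linarith [hd d h1]) (fun d h1 => le_disc hA.1 hA.2.1 hδ h1) p m α β
    tau_mem := fun p m α β => hmem p m α β
    symm_mem := fun X α x hx => by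
      obtain ⟨hb, hm⟩ := (mem_cone_filt φ _ _).1 hx
      rw [hP']
      refine (mem_cone_filt _ _ 0).2 ⟨?_, ?_⟩
      · rw [fst_extendIso_symm]
        refine (yoneda A (L (n + 1))).mem_of_le hb ?_
        simp only [Pi.zero_apply]
        linarith
      · rw [snd_extendIso_symm]
        -- The homotopy term lies in level α + Q and the previous inverse adds P, with P + Q ≤ 2Q -
        -- ξ. This doubling is the source of the powers of 2.
        refine T.red.mod.mem_of_le (T.symm_mem X (α + Q) _ (sub_mem ?_ ?_)) (by linarith)
        · exact K.mod.mem_of_le hm (by linarith)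
        -- The homotopy term at b is the second component of the new τ₁ at (b, 0), and τ₁ is
        -- filtered. Relative to the shift ρ_{n+1} + Q, the element b has level at most α + Q.
        · have h3 := hmem (.nil X) (φ.coneFst (ρ (n + 1)) (δ (n + 1)) X x, 0) 0 (α + Q) (.nil X)
            ((mem_cone_filt _ _ 0).2 ⟨?_, zero_mem _⟩)
          · have h4 := ((mem_cone_filt φ _ _).1 h3).2
            simp only [Path.length, zero_add, disc_one, add_zero] at h4
            have h5 : (unitHtpy T.tau φ (T.vec φ e) e h).map (.nil X)
                (φ.coneFst (ρ (n + 1)) (δ (n + 1)) X x) + T.tau.map (.nil X) 0 ∈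
                K.mod.filt X (α + Q) := h4
            rwa [map_zero, add_zero] at h5
          · refine (yoneda A (L (n + 1))).mem_of_le hb ?_
            simp only [Pi.zero_apply]
            linarith
    proj_mem := fun X α x hx j => by
      obtain ⟨hb, hm⟩ := (mem_cone_filt _ _ 0).1 hx
      induction j using Fin.lastCases with
      | last =>
        refine (congrArg (· ∈ A.filt X (L (n + 1)) (α - ρ (n + 1)))
          (T.red.step_proj_last _ _ 0 X x)).mpr ?_
        refine A.mem_of_le hb ?_
        simp only [Pi.zero_apply]
        linarith
      | cast j =>
        refine (congrArg (· ∈ A.filt X (L j) (α - ρ j))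
          (T.red.step_proj_castSucc _ _ 0 X j x)).mpr ?_
        exact T.proj_mem X α _ hm j
    incl_mem := fun X j α => by
      rw [hP']
      induction j using Fin.lastCases with
      | last =>
        intro b hb
        have hb := (K.step_incl_last_mem_iff φ _ _).1 hb
        refine (T.red.step_incl_last_mem_iff _ _ 0).2 (A.mem_of_le hb ?_)
        simp only [Pi.zero_apply]
        linarith
      | cast j =>
        intro b hb
        have hb := (K.step_incl_castSucc_mem_iff φ _ _).1 hb
        exact (T.red.step_incl_castSucc_mem_iff _ _ 0).2
          (T.red.mod.mem_of_le (T.incl_mem X j α b hb) (by linarith))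
    incl_zero_mem_iff := fun {X} b α =>
      (T.red.step_incl_castSucc_mem_iff _ _ 0 (j := 0)).trans (T.incl_zero_mem_iff b α) }

end Step

end Reduction

/-! ### Existence of reductions and transport of the operations -/

theorem exists_reduction (h2 : (2 : R) = 0) {ε : ℕ → ℝ} (hA : A.HasDiscrepancy ε)
    {e : ∀ X : A.Ob, A.Hom X X} {u : ℝ} (he : HUnital A e u) {n : ℕ} {ρ : ℕ → ℝ}
    (hρ : ρ 0 = 0) {δ : ℕ → ℕ → ℝ} {K : SplitModule A L n} (hK : IsIteratedCone ρ δ n K) {κ : ℝ}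
    (huκ : u ≤ κ) (hU : ∀ i ≤ n, AssumptionURe A e (L i) κ) : Nonempty (Reduction κ ε ρ δ K) := by
  induction hK with
  | base => exact ⟨.base h2 hA hρ⟩
  | @step n K hK φ hφ ih =>
    obtain ⟨T⟩ := ih fun i hi => hU i (by omega)
    choose h hhκ hh using hU (n + 1) le_rfl
    exact ⟨T.step h2 (he.cycle _) hA (hK.step φ hφ).nonneg hφ he.nonneg huκ (he.mem _) hhκ hh⟩

/-- The structure of an `A_∞`-module on `M(X)` transported from `N(X)` along linear isomorphisms,
with the filtrations of `M(X)`. -/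
def FiltModule.transport (M N : FiltModule A) (t : ∀ X, M.carrier X ≃ₗ[R] N.carrier X) :
    FiltModule A where
  carrier := M.carrier
  act {X Y} p := (t X).symm.toLinearMap.comp ((N.act p).comp (t Y).toLinearMap)
  act_add p a b q := by rw [N.act_add, LinearMap.add_comp, LinearMap.comp_add]
  act_smul p r a q := by rw [N.act_smul, LinearMap.smul_comp, LinearMap.comp_smul]
  rel {X Y} p m := by
    apply (t X).injective
    simp only [map_add, Path.sumSplit₃, Path.map_sumSplit, map_zero, LinearMap.comp_apply,
      LinearEquiv.coe_coe, LinearEquiv.apply_symm_apply]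
    exact N.rel p (t Y m)
  filt := M.filt
  filt_mono := M.filt_mono

namespace Reduction

variable {κ : ℝ} {ε : ℕ → ℝ} {ρ : ℕ → ℝ} {δ : ℕ → ℕ → ℝ} {n : ℕ} {K : SplitModule A L n}
  (T : Reduction κ ε ρ δ K)

theorem iso_mem {X : A.Ob} {m : T.red.mod.carrier X} {α : ℝ} (hm : m ∈ T.red.mod.filt X α) :
    T.iso X m ∈ K.mod.filt X α := by
  have h := T.tau_mem (.nil X) m 0 α (.nil X) hm
  simp only [Path.length, zero_add, disc_one, add_zero] at h
  rw [T.iso_apply]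
  exact h

theorem d_mem {X : A.Ob} {m : T.red.mod.carrier X} {α : ℝ} (hm : m ∈ T.red.mod.filt X α) :
    T.red.mod.d X m ∈ T.red.mod.filt X α := by
  have h := T.act_mem (.nil X) m 0 α (.nil X) hm
  simp only [Path.length, zero_add, disc_one, add_zero] at h
  exact h

/-- As τ₁ is a chain map, conjugating the differential of K by it gives back that of red, with its
chain sums. -/
theorem d_transport (h2 : (2 : R) = 0) (X : A.Ob) :
    (T.red.mod.transport K.mod T.iso).d X = T.red.mod.d X := by
  have h : ∀ m : T.red.mod.carrier X,
      (T.iso X).symm (K.mod.d X (T.iso X m)) = T.red.mod.d X m := fun m => by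
    rw [LinearEquiv.symm_apply_eq, T.iso_apply, T.iso_apply, T.tau.d_first h2]
  exact LinearMap.ext h

end Reduction

/-- A module homomorphism whose first order part is bijective is a quasi-isomorphism. -/
theorem ModHom.isQuasiIso_of_bijective (h2 : (2 : R) = 0) {M N : FiltModule A} (f : ModHom M N)
    (hf : ∀ X, Function.Bijective (f.first X)) : f.IsQuasiIso := by
  refine fun X => ⟨fun m _ hm => ?_, fun n hn => ?_⟩
  · obtain ⟨n, hn⟩ := hm
    obtain ⟨m', rfl⟩ := (hf X).2 n
    exact ⟨m', (hf X).1 (hn.trans (f.d_first h2 X m'))⟩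
  · obtain ⟨m, rfl⟩ := (hf X).2 n
    refine ⟨m, (hf X).1 ?_, 0, by rw [map_zero, add_zero]⟩
    rw [← f.d_first h2, hn, map_zero]

end WeaklyFiltered

theorem theorem2 :
    ∃ (B C : ℕ → ℝ) (D : ℕ → ℕ → ℝ),
      ∀ (R : Type u) [CommRing R] (h2 : (2 : R) = 0) (A : FiltCat.{u, v, w} R)
        (εA : ℕ → ℝ) (hA : A.HasDiscrepancy εA)
        (e : ∀ X : A.Ob, A.Hom X X) (uA : ℝ) (he : HUnital A e uA)
        (r : ℕ) (L : ℕ → A.Ob) (ρ : ℕ → ℝ) (hρ0 : ρ 0 = 0) (δ : ℕ → ℕ → ℝ)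
        (K : SplitModule A L r) (hK : IsIteratedCone ρ δ r K)
        (κ : ℝ) (hκ : 2 * uA + εA 2 ≤ κ)
        (hUe : AssumptionUe A e κ)
        (hURe : ∀ i ≤ r, AssumptionURe A e (L i) κ)
        (hUw : ∀ i ≤ r, AssumptionUw e (yoneda A (L i)) κ),
      ∃ M : SplitModule A L r,
        (∃ εM : ℕ → ℝ, M.mod.HasDiscrepancy εM) ∧
        -- the differential of `M`
        (∀ (X : A.Ob) (i j : Fin (r + 1)), j < i → M.entry M X (M.mod.d X) i j = 0) ∧
        (∀ (X : A.Ob) (i : Fin (r + 1)) (b : A.Hom X (L i)),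
          M.entry M X (M.mod.d X) i i b = A.mu (.single b)) ∧
        (∃ c : ∀ q p : ℕ, A.Hom (L q) (L p),
          (∀ (X : A.Ob) (i j : Fin (r + 1)), i < j → ∀ b : A.Hom X (L j),
            M.entry M X (M.mod.d X) i j b = chainSum c i j b) ∧
          (∀ q p : ℕ, p < q → q ≤ r →
            c q p ∈ A.filt (L q) (L p) (ρ q - ρ p + B q * xi κ εA δ q))) ∧
        -- the quasi-isomorphism
        ∃ (σ : ModHom K.mod M.mod) (ρσ : ℝ) (εσ : ℕ → ℝ),
          σ.IsQuasiIso ∧ σ.Shifts ρσ εσ ∧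
          ρσ ≤ C r * xi κ εA δ r ∧
          (∀ d, 1 ≤ d → εσ d ≤ D r d * chi εA δ r d) ∧
          -- its first order part and the inverse of it
          (∀ (X : A.Ob) (m : K.mod.carrier X), σ.first X (K.mod.d X m) = M.mod.d X (σ.first X m)) ∧
          (∀ X : A.Ob, ∃ s : K.mod.carrier X ≃ₗ[R] M.mod.carrier X,
            s.toLinearMap = σ.first X ∧
            ∀ (α : ℝ), ∀ m ∈ M.mod.filt X α, s.symm m ∈ K.mod.filt X α) ∧
          (∀ (X : A.Ob) (i j : Fin (r + 1)), j < i → K.entry M X (σ.first X) i j = 0) ∧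
          (∀ (X : A.Ob) (i : Fin (r + 1)), K.entry M X (σ.first X) i i = LinearMap.id) ∧
          -- the diagonal elements
          (∀ (X : A.Ob) (j : Fin (r + 1)) (α : ℝ) (b : A.Hom X (L j)),
            K.incl X j b ∈ K.mod.filt X α →
              M.incl X j (K.entry M X (σ.first X) j j b) ∈ M.mod.filt X (α + ρσ)) ∧
          (∀ (X : A.Ob) (b : A.Hom X (L 0)),
            K.mod.d X (K.incl X 0 b) = K.incl X 0 (A.mu (.single b)) ∧
            M.mod.d X (M.incl X 0 b) = M.incl X 0 (A.mu (.single b)) ∧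
            ∀ α : ℝ, K.incl X 0 b ∈ K.mod.filt X α ↔ M.incl X 0 b ∈ M.mod.filt X α) := by
  -- C_r = 2^r bounds the shift factor 2^r - 1 of τ₁⁻¹; D = 0 because σ is strict.
  refine ⟨fun n => 2 ^ n, fun n => 2 ^ n, fun _ _ => 0, ?_⟩
  intro R _ h2 A εA hA e uA he r L ρ hρ0 δ K hK κ hκ _ hURe _
  have hu := he.nonneg
  have hε2 := hA.1 2 (by norm_num)
  have hδ := hK.nonneg
  have hκ0 : 0 ≤ κ := by linarith
  -- The inequality u ≤ κ follows from 2u + ε₂ ≤ κ, as u and ε₂ are non-negative.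
  obtain ⟨T⟩ := exists_reduction h2 hA he hρ0 hK (by linarith) hURe
  have hξ := xi_nonneg hA.1 hκ0 hδ
  have hP0 : 0 ≤ shiftBound κ εA δ r :=
    mul_nonneg (sub_nonneg.2 (one_le_pow₀ (by norm_num))) hξ
  -- The module `M` has the pieces, filtrations and differential of the iterated cone `T.red`; its
  -- higher operations are those of `K`, conjugated by the first order part of `T.tau`.
  let M : SplitModule A L r := ⟨T.red.mod.transport K.mod T.iso, T.red.split⟩
  have hd : ∀ X, M.mod.d X = T.red.mod.d X := fun X => T.d_transport h2 X
  have hd0 : ∀ (X : A.Ob) (i : Fin (r + 1)) (b : A.Hom X (L i)),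
      M.entry M X (M.mod.d X) i i b = A.mu (.single b) := fun X i b =>
    (congrArg (fun g => T.red.proj X i (g (T.red.incl X i b))) (hd X)).trans
      (T.act_self (.nil X) i b)
  have hdl : ∀ (X : A.Ob) (i j : Fin (r + 1)), j < i → M.entry M X (M.mod.d X) i j = 0 :=
    fun X i j hij => LinearMap.ext fun b =>
      (congrArg (fun g => T.red.proj X i (g (T.red.incl X j b))) (hd X)).trans
        (T.act_gt (.nil X) i j hij b)
  let σ : ModHom K.mod M.mod := .strict h2 (fun X => (T.iso X).symm.toLinearMap) fun p m =>
    congrArg (fun m => (T.iso _).symm (K.mod.act p m)) ((T.iso _).apply_symm_apply m).symm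
  have hσd : ∀ (X : A.Ob) (m : K.mod.carrier X),
      σ.first X (K.mod.d X m) = M.mod.d X (σ.first X m) := fun X m => (σ.d_first h2 X m).symm
  have hdiag : ∀ (X : A.Ob) (i : Fin (r + 1)), K.entry M X (σ.first X) i i = LinearMap.id :=
    fun X i => LinearMap.ext fun b => T.iso_self X i b
  -- For d ≥ 2 the operation τ₁⁻¹ ∘ μ_d^K(…, τ₁) costs the discrepancy of K and the shift of τ₁⁻¹,
  -- while τ₁ costs nothing. For d = 1 it is the differential of red, which is filtered.
  refine ⟨M, ⟨fun d => if d = 1 then 0 else shiftBound κ εA δ r + disc εA δ r d, ?_, rfl, ?_⟩,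
    hdl, hd0, ⟨T.c, ?_, T.c_mem⟩, σ, shiftBound κ εA δ r, fun _ => 0, ?_, ⟨?_, ?_⟩, ?_, ?_, hσd,
    ?_, ?_, hdiag, ?_, ?_⟩
  · intro d _
    dsimp only
    split_ifs
    exacts [le_rfl, add_nonneg hP0 (disc_nonneg hA.1 hδ d)]
  · intro X Y p m α β hp hm
    cases p with
    | nil =>
      cases hp
      have h := T.d_mem hm
      rw [← hd] at h
      exact T.red.mod.mem_of_le h (by simp [Path.length])
    | cons a p =>
      refine T.red.mod.mem_of_le
        (T.symm_mem X _ _ (hK.act_mem hA _ _ α β hp (T.iso_mem hm))) (le_of_eq ?_)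
      have hlen : (Path.cons a p).length + 1 ≠ 1 := Nat.succ_ne_succ_iff.2 (Nat.succ_ne_zero _)
      simp only [if_neg hlen]
      ring
  · intro X i j hij b
    exact (congrArg (fun g => T.red.proj X i (g (T.red.incl X j b))) (hd X)).trans
      (T.act_lt (.nil X) i j hij b)
  · exact σ.isQuasiIso_of_bijective h2 fun X => (T.iso X).symm.bijective
  · intro d _
    exact le_rfl
  · intro X Y p m α β hp hm
    cases hp with
    | nil => exact T.red.mod.mem_of_le (T.symm_mem X β m hm) (by linarith)
    | cons _ _ => exact zero_mem _
  · exact mul_le_mul_of_nonneg_right (by linarith) hξ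
  · intro d _
    simp
  · exact fun X => ⟨(T.iso X).symm, rfl, fun α m hm => T.iso_mem hm⟩
  · exact fun X i j hij => LinearMap.ext fun b => T.iso_gt X i j hij b
  · intro X j α b hb
    rw [hdiag]
    exact T.incl_mem X j α b hb
  · intro X b
    refine ⟨hK.d_incl_zero b, M.ext_proj fun i => ?_, fun α =>
      (hK.incl_zero_mem_iff b).trans (T.incl_zero_mem_iff b α).symm⟩
    -- The entries of the differential below the diagonal vanish, so C(X, L₀) is a subcomplex of
    -- M(X).
    rcases (Fin.zero_le i).eq_or_lt with rfl | hi
    · exact (hd0 X 0 b).trans (M.proj_incl_self X 0 _).symm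
    · exact (congrArg (fun g => g b) (hdl X i 0 hi)).trans (M.proj_incl_of_ne X hi.ne' _).symm
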